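/- An oriented graph is a finite directed graph without loops in which any two vertices are joined by at most one arc; write $V(\overrightarrow{G})$ and $E(\overrightarrow{G})$ for its sets of vertices and of arcs. Pushing a set $S$ of vertices reverses every arc with exactly one end in $S$; two oriented graphs on the same vertex set are push equivalent if one arises from the other by pushing some set of vertices. A pushable homomorphism of $\overrightarrow{G}$ to $\overrightarrow{H}$ is a map $f:V(\overrightarrow{G})\to V(\overrightarrow{H})$ for which there is an oriented graph $\overrightarrow{G}'$ push equivalent to $\overrightarrow{G}$ such that $f(u)f(v)$ is an arc of $\overrightarrow{H}$ for every arc $uv$ of $\overrightarrow{G}'$. An unbalanced $\overrightarrow{C_4}$ is an orientation of the $4$-cycle for which no set of vertices can be pushed so as to obtain equally many forward and backward arcs (that is, one with an odd number of forward arcs; any two of these are isomorphic). An oriented graph $\overrightarrow{G}$ is unbalanced $\overrightarrow{C_4}$-pushable critical if it admits no pushable homomorphism to the unbalanced $\overrightarrow{C_4}$, but each of its proper subgraphs does. Let $\overrightarrow{W}$ be the oriented graph with the seven vertices $v_1,v_2,v_3,v_4,u_1,u_2,u_3$ and the nine arcs $$v_1u_1,\ v_1u_2,\ v_1u_3,\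 u_1v_2,\ v_2u_2,\ u_2v_3,\ v_3u_3,\ v_4u_1,\ u_3v_4.$$ **Theorem.** Let $\overrightarrow{G}$ be an oriented graph whose underlying graph is bipartite. If $\overrightarrow{G}$ is unbalanced $\overrightarrow{C_4}$-pushable critical and is not isomorphic, up to push equivalence, to $\overrightarrow{W}$ (that is, no oriented graph push equivalent to $\overrightarrow{G}$ is isomorphic to $\overrightarrow{W}$), then $$|E(\overrightarrow{G})|\ \ge\ \frac{4\,|V(\overrightarrow{G})|}{3}.$$ -/

import Mathlib

/-- An oriented graph with vertex set `V`: a directed graph without loops and without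
pairs of opposite arcs (asymmetry excludes both), and with at most one arc between two vertices. -/
structure OrientedGraph (V : Type*) where
  Arc : V → V → Prop
  asymm : ∀ u v, Arc u v → ¬ Arc v u

namespace OrientedGraph

variable {V W : Type*}

/-- The underlying simple graph. -/
def underlying (G : OrientedGraph V) : SimpleGraph V where
  Adj u v := G.Arc u v ∨ G.Arc v u
  symm := ⟨fun _ _ h => h.symm⟩
  loopless := ⟨fun v h => h.elim (fun h => G.asymm v v h h) (fun h => G.asymm v v h h)⟩

/-- The number of arcs, which is also the number of edges of the underlying graph. -/
noncomputable def numArcs (G : OrientedGraph V) : ℕ :=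
  {p : V × V | G.Arc p.1 p.2}.ncard

/-- Pushing the set `S`, that is, reversing once for each `s ∈ S` all arcs incident to `s`:
the arcs with exactly one end in `S` are reversed and the others are kept. -/
def push (G : OrientedGraph V) (S : Set V) : OrientedGraph V where
  Arc u v := ((u ∈ S ↔ v ∈ S) ∧ G.Arc u v) ∨ (¬ (u ∈ S ↔ v ∈ S) ∧ G.Arc v u)
  asymm := by
    rintro u v (⟨h, a⟩ | ⟨h, a⟩) (⟨h', b⟩ | ⟨h', b⟩)
    · exact G.asymm _ _ a b
    · exact h' h.symm
    · exact h h'.symm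
    · exact G.asymm _ _ a b

/-- `G'` is obtained from `G` by pushing some set of vertices. -/
def PushEquivalent (G G' : OrientedGraph V) : Prop :=
  ∃ S : Set V, G' = G.push S

/-- `f` is a homomorphism of oriented graphs. -/
def IsHom (G : OrientedGraph V) (H : OrientedGraph W) (f : V → W) : Prop :=
  ∀ u v, G.Arc u v → H.Arc (f u) (f v)

/-- `f` is a pushable homomorphism: a homomorphism to `H` of some graph push equivalent to `G`. -/
def IsPushableHom (G : OrientedGraph V) (H : OrientedGraph W) (f : V → W) : Prop :=
  ∃ G' : OrientedGraph V, G.PushEquivalent G' ∧ G'.IsHom H f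

/-- `G` admits a pushable homomorphism to `H`. -/
def PushablyColorable (G : OrientedGraph V) (H : OrientedGraph W) : Prop :=
  ∃ f : V → W, G.IsPushableHom H f

/-- Isomorphism of oriented graphs. -/
def Isomorphic (G : OrientedGraph V) (H : OrientedGraph W) : Prop :=
  ∃ e : V ≃ W, ∀ u v, G.Arc u v ↔ H.Arc (e u) (e v)

/-- `H`, with vertex set `s ⊆ V`, is a subgraph of `G`. -/
def IsSubgraph (G : OrientedGraph V) (s : Set V) (H : OrientedGraph s) : Prop :=
  ∀ u v : s, H.Arc u v → G.Arc u v

/-- `H`, with vertex set `s ⊆ V`, is a proper subgraph of `G`: a subgraph in which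
some vertex or some arc of `G` is missing. -/
def IsProperSubgraph (G : OrientedGraph V) (s : Set V) (H : OrientedGraph s) : Prop :=
  G.IsSubgraph s H ∧ (s ≠ Set.univ ∨ ∃ u v : s, G.Arc u v ∧ ¬ H.Arc u v)

/-- `G` has no pushable homomorphism to `H`, but all its proper subgraphs have one. -/
def IsPushableCritical (G : OrientedGraph V) (H : OrientedGraph W) : Prop :=
  ¬ G.PushablyColorable H ∧
    ∀ (s : Set V) (K : OrientedGraph s), G.IsProperSubgraph s K → K.PushablyColorable H

/-- `C` is an unbalanced oriented 4-cycle (on the vertices `0, 1, 2, 3` in this cyclic order):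
no set of vertices can be pushed so that the numbers of forward arcs `i → i + 1` and of
backward arcs `i + 1 → i` become equal. -/
def IsUnbalancedFourCycle (C : OrientedGraph (Fin 4)) : Prop :=
  C.underlying = SimpleGraph.cycleGraph 4 ∧
    ∀ S : Set (Fin 4),
      {i : Fin 4 | (C.push S).Arc i (i + 1)}.ncard ≠ {i : Fin 4 | (C.push S).Arc (i + 1) i}.ncard

/-- The exceptional graph on 7 vertices with 9 arcs. The vertices `0, 1, 2, 3` are
`v₁, v₂, v₃, v₄` and the vertices `4, 5, 6` are `u₁, u₂, u₃`. -/
def exceptionalW : OrientedGraph (Fin 7) where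
  Arc a b := (a, b) ∈ ({(0, 4), (0, 5), (0, 6), (4, 1), (1, 5), (5, 2), (2, 6), (3, 4), (6, 3)} :
    Finset (Fin 7 × Fin 7))
  asymm := by decide

end OrientedGraph

/-!
A homomorphism of a push-equivalent graph to the unbalanced 4-cycle sends each vertex to one of the
two vertices of its side, and it may push the vertex or not. For a bipartite graph it is therefore
a colouring with four colours in `ZMod 2 × ZMod 2`, with one equation over `ZMod 2` for every edge;
the orientation enters only through a sign of the edge, up to switching.

In a critical graph all degrees are at least two and vertices of degree two are not adjacent. If
there are fewer than `4 n / 3` arcs, discharging yields a tree component `K` of the graph on the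
vertices of degree at least three, all of whose vertices have degree exactly three. Colour
everything outside `K` and uncolour the vertices of degree two. Each vertex of degree two then
forbids one colour of its neighbour in `K`, or one clash between its two neighbours in `K`, so that
every vertex of the tree `K` has at most three constraints. Deleting leaves shows that such a
problem on a tree is solvable, with one exception: a star with three leaves that clash pairwise.
The star together with the three vertices of degree two behind the clashes is not colourable, hence
it is the whole graph, and solving for the pushed set identifies it with `exceptionalW`.
-/

/-! ### Colours of signed graphs -/

/-- A signed graph: a simple graph with a sign in `ZMod 2` on every edge. The values of `sign` on
pairs of non-adjacent vertices are irrelevant. -/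
structure SignedGraph (V : Type*) where
  graph : SimpleGraph V
  sign : V → V → ZMod 2
  sign_comm : ∀ u v, sign u v = sign v u

namespace SignedGraph

section Colors

/-- A colour `(x, s)` of a vertex of a bipartite graph: `x` is one of the two vertices of its side
of the unbalanced 4-cycle, and `s` tells whether the vertex is pushed. -/
abbrev Color := ZMod 2 × ZMod 2

/-- The colours `c` and `d` are allowed at the ends of an edge of sign `τ`. The product `c.1 * d.1`
is the sign pattern of an unbalanced 4-cycle: one edge differs from the other three. -/
def Compatible (τ : ZMod 2) (c d : Color) : Prop := c.2 + d.2 + c.1 * d.1 = τ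

/-- The relation between the end colours of a path of length two that prevents the middle vertex
from being coloured; here `t` is one more than the sign of the path. -/
def Clash (t : ZMod 2) (c d : Color) : Prop := c.1 = d.1 ∧ c.2 + d.2 = t

instance (τ : ZMod 2) (c d : Color) : Decidable (Compatible τ c d) :=
  inferInstanceAs (Decidable (_ = _))

instance (t : ZMod 2) (c d : Color) : Decidable (Clash t c d) :=
  inferInstanceAs (Decidable (_ ∧ _))

variable {τ τ' t : ZMod 2} {c c' d d' : Color}

theorem Compatible.symm (h : Compatible τ c d) : Compatible τ d c := by
  unfold Compatible at *
  rw [← h]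
  ring

theorem Clash.symm (h : Clash t c d) : Clash t d c :=
  ⟨h.1.symm, by rw [add_comm, h.2]⟩

theorem exists_compatible (τ : ZMod 2) (c : Color) : ∃ d, Compatible τ d c :=
  ⟨(0, τ + c.2), by revert τ c; decide⟩

theorem exists_compatible_path (τ₁ τ₂ τ₃ : ZMod 2) (c c' : Color) :
    ∃ d d', Compatible τ₁ d c ∧ Compatible τ₂ d d' ∧ Compatible τ₃ d' c' := by
  revert τ₁ τ₂ τ₃ c c'
  decide

theorem exists_compatible_iff_not_clash :
    (∃ d, Compatible τ d c ∧ Compatible τ' d c') ↔ ¬ Clash (τ + τ' + 1) c c' := by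
  revert τ τ' c c'
  decide

theorem clash_of_compatible (h : Compatible τ c d) (h' : Compatible τ' c d') (hd : d.1 = d'.1) :
    Clash (τ + τ') d d' := by
  revert τ τ' c d d'
  decide

theorem exists_fst_not_clash (h : ¬ Clash (t + τ + τ') c c') :
    ∃ x : ZMod 2, c.2 + x * c.1 + τ + (c'.2 + x * c'.1 + τ') ≠ t := by
  revert t τ τ' c c'
  decide

theorem exists_compatible_of_card_le_two (τ : ZMod 2) (F : Finset Color) (hF : F.card ≤ 2) :
    ∃ y : Color, ∀ c ≠ y, ∃ d ∉ F, Compatible τ d c := by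
  revert τ F
  decide

theorem exists_compatible_not_clash (τ t : ZMod 2) (f : Color) :
    ∃ y z : Color, ∀ c ≠ y, ∀ e ≠ z, ∃ d ≠ f, Compatible τ d c ∧ ¬ Clash t d e := by
  revert τ t f
  decide

theorem exists_compatible_not_clash_of_card_le_one (τ t : ZMod 2) (F : Finset Color)
    (hF : F.card ≤ 1) :
    ∃ y z : Color, ∀ c ≠ y, ∀ e ≠ z, ∃ d ∉ F, Compatible τ d c ∧ ¬ Clash t d e := by
  obtain ⟨f, hf⟩ := Finset.card_le_one_iff_subset_singleton.1 hF
  obtain ⟨y, z, h⟩ := exists_compatible_not_clash τ t f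
  refine ⟨y, z, fun c hc e he => ?_⟩
  obtain ⟨d, hd, hcompat⟩ := h c hc e he
  exact ⟨d, fun hdF => hd (Finset.mem_singleton.1 (hf hdF)), hcompat⟩

/-- A vertex of degree one with at most two restrictions besides its edge, at most one of them a
clash, can be coloured last, at the price of one forbidden colour `y` at its neighbour and at most
one at the other end of the clash. -/
theorem exists_forbidden_of_leaf {V : Type*} [Fintype V] (τ : ZMod 2) (F : Finset Color)
    (D : V → Finset (ZMod 2)) (hD : ∑ v, (D v).card ≤ 1)
    (hFD : F.card + ∑ v, (D v).card ≤ 2) :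
    ∃ (y : Color) (Z : V → Finset Color), (∀ v, (Z v).card ≤ (D v).card) ∧
      ∀ c ≠ y, ∀ φ : V → Color, (∀ v, φ v ∉ Z v) →
        ∃ d ∉ F, Compatible τ d c ∧ ∀ v, ∀ t ∈ D v, ¬ Clash t d (φ v) := by
  classical
  by_cases hempty : ∀ v, D v = ∅
  · obtain ⟨y, hy⟩ := exists_compatible_of_card_le_two τ F (by omega)
    refine ⟨y, fun _ => ∅, by simp, fun c hc φ _ => ?_⟩
    obtain ⟨d, hdF, hd⟩ := hy c hc
    exact ⟨d, hdF, hd, by simp [hempty]⟩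
  · push Not at hempty
    obtain ⟨v, t, ht⟩ := hempty
    have hpos : 1 ≤ (D v).card := Finset.card_pos.2 ⟨t, ht⟩
    have hunique : ∀ u, ∀ s ∈ D u, u = v ∧ s = t := fun u s hs => by
      have hle : (Finset.univ.sigma D).card ≤ 1 := by rwa [Finset.card_sigma]
      simpa using Finset.card_le_one.1 hle ⟨u, s⟩ (by simpa using hs) ⟨v, t⟩ (by simpa using ht)
    have hsum : (D v).card ≤ ∑ u, (D u).card :=
      Finset.single_le_sum (f := fun v => (D v).card) (by simp) (Finset.mem_univ v)
    obtain ⟨y, z, hyz⟩ := exists_compatible_not_clash_of_card_le_one τ t F (by omega)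
    refine ⟨y, fun u => if u = v then {z} else ∅, fun u => ?_, fun c hc φ hφ => ?_⟩
    · rcases eq_or_ne u v with rfl | huv
      · simpa using hpos
      · simp [huv]
    · obtain ⟨d, hdF, hd, hclash⟩ := hyz c hc (φ v) (by simpa using hφ v)
      refine ⟨d, hdF, hd, fun u s hs => ?_⟩
      obtain ⟨rfl, rfl⟩ := hunique u s hs
      exact hclash

end Colors

end SignedGraph

open SignedGraph

/-! ### Trees and odd cycles -/

section GraphLemmas

open scoped Classical in
theorem degree_induce_eq_card_filter {V : Type*} [Fintype V] (G : SimpleGraph V) (s : Set V)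
    (v : s) [Fintype ((G.induce s).neighborSet v)] :
    (G.induce s).degree v = {u | u ∈ s ∧ G.Adj v u}.toFinset.card := by
  rw [← SimpleGraph.card_neighborFinset_eq_degree, ← Finset.card_map (.subtype (· ∈ s))]
  congr 1
  ext u
  simp [and_comm]

variable {V : Type*} {G : SimpleGraph V} {s : Set V}

theorem exists_eq_or_eq_of_degree_eq_two {m x : V} [Fintype (G.neighborSet m)]
    (hm : G.degree m = 2) (hx : G.Adj m x) :
    ∃ y, y ≠ x ∧ G.Adj m y ∧ ∀ z, G.Adj m z → z = x ∨ z = y := by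
  classical
  obtain ⟨a, b, hab, heq⟩ := Finset.card_eq_two.1 ((G.card_neighborFinset_eq_degree m).trans hm)
  have hmem : ∀ z, G.Adj m z ↔ z = a ∨ z = b := fun z => by
    rw [← SimpleGraph.mem_neighborFinset, heq, Finset.mem_insert, Finset.mem_singleton]
  rcases (hmem x).1 hx with rfl | rfl
  · exact ⟨b, hab.symm, (hmem b).2 (.inr rfl), fun z => (hmem z).1⟩
  · exact ⟨a, hab, (hmem a).2 (.inl rfl), fun z hz => ((hmem z).1 hz).symm⟩

theorem eq_univ_of_forall_adj_mem (hG : G.Preconnected) (hs : s.Nonempty)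
    (h : ∀ u ∈ s, ∀ v, G.Adj u v → v ∈ s) : s = Set.univ := by
  obtain ⟨u, hu⟩ := hs
  refine Set.eq_univ_of_forall fun v => by_contra fun hv => ?_
  obtain ⟨d, -, hfst, hsnd⟩ := (hG u v).some.exists_boundary_dart s hu hv
  exact hsnd (h _ hfst _ d.adj)

theorem isTree_induce_of_neighborSet_subsingleton (hG : G.IsTree) (hs : s.Nonempty)
    (h : ∀ v ∉ s, (G.neighborSet v).Subsingleton) : (G.induce s).IsTree :=
  have := hs.to_subtype
  ⟨⟨hG.1.preconnected.induce_of_degree_eq_one h⟩, hG.2.induce s⟩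

theorem exists_forall_adj_add_eq_of_isTree {V : Type*} [Finite V] {G : SimpleGraph V}
    {M : Type*} [AddCommGroup M] (hG : G.IsTree) {τ : V → V → M} (hτ : ∀ u v, τ u v = τ v u) :
    ∃ g : V → M, ∀ u v, G.Adj u v → g u + g v = τ u v := by
  classical
  have := Fintype.ofFinite V
  induction hn : Fintype.card V using Nat.strong_induction_on generalizing V with
  | _ n ih =>
  rcases subsingleton_or_nontrivial V with hV | hV
  · exact ⟨0, fun u v huv => absurd (Subsingleton.elim u v) huv.ne⟩
  obtain ⟨a, ha⟩ := hG.exists_vert_degree_one_of_nontrivial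
  obtain ⟨b, hab, hb⟩ := SimpleGraph.degree_eq_one_iff_existsUnique_adj.1 ha
  have hba : b ∈ ({a}ᶜ : Set V) := hab.ne'
  obtain ⟨g, hg⟩ := ih _ (hn ▸ Fintype.card_subtype_lt (x := a) (by simp))
    (V := ({a}ᶜ : Set V)) (τ := fun u v => τ u v)
    (isTree_induce_of_neighborSet_subsingleton hG ⟨b, hba⟩ (by
      rintro v hv x hx y hy
      obtain rfl : v = a := by simpa using hv
      rw [hb x hx, hb y hy])) (fun _ _ => hτ _ _) inferInstance rfl
  refine ⟨fun v => if hv : v = a then τ a b - g ⟨b, hba⟩ else g ⟨v, hv⟩, fun u v huv => ?_⟩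
  by_cases hu : u = a
  · subst hu
    obtain rfl := hb v huv
    simp [huv.ne']
  · by_cases hv : v = a
    · subst hv
      obtain rfl := hb u huv.symm
      simp [hu, hτ u v]
    · simpa [hu, hv] using hg ⟨u, hu⟩ ⟨v, hv⟩ huv

theorem isBipartite_induce_iff :
    (G.induce s).IsBipartite ↔ ∃ g : V → ZMod 2, ∀ u ∈ s, ∀ v ∈ s, G.Adj u v → g u ≠ g v := by
  classical
  constructor
  · rintro ⟨(C : (G.induce s).Coloring (ZMod 2))⟩
    exact ⟨fun v => if hv : v ∈ s then C ⟨v, hv⟩ else 0, fun u hu v hv huv h =>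
      C.valid (v := ⟨u, hu⟩) (w := ⟨v, hv⟩) huv (by simpa [hu, hv] using h)⟩
  · rintro ⟨g, hg⟩
    exact ⟨.mk (fun v => g v) fun {u v} huv => hg u u.2 v v.2 huv⟩

/-- The vertex set `s` induces a non-bipartite subgraph of `G`, and is minimal with this
property; in a finite graph it is the vertex set of an odd cycle. -/
structure IsBipartiteCritical (G : SimpleGraph V) (s : Set V) : Prop where
  not_isBipartite : ¬ (G.induce s).IsBipartite
  isBipartite_sdiff_singleton : ∀ v ∈ s, (G.induce (s \ {v})).IsBipartite

theorem exists_isBipartiteCritical [Finite V] (h : ¬ G.IsBipartite) :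
    ∃ s, IsBipartiteCritical G s := by
  have huniv : ¬ (G.induce Set.univ).IsBipartite := fun ⟨C⟩ =>
    h ⟨C.comp (SimpleGraph.induceUnivIso G).symm.toHom⟩
  obtain ⟨s, -, hs⟩ := exists_minimal_le_of_wellFoundedLT
    (fun s : Set V => ¬ (G.induce s).IsBipartite) Set.univ huniv
  exact ⟨s, hs.prop, fun v hv => by_contra fun hbip =>
    (hs.le_of_le hbip Set.sdiff_subset hv).2 rfl⟩

theorem IsBipartiteCritical.nonempty (hs : IsBipartiteCritical G s) : s.Nonempty := by
  by_contra! hempty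
  exact hs.not_isBipartite (isBipartite_induce_iff.2 ⟨0, by simp [hempty]⟩)

theorem IsBipartiteCritical.exists_adj_ne (hs : IsBipartiteCritical G s) {v : V} (hv : v ∈ s)
    (x : V) : ∃ u ∈ s, G.Adj v u ∧ u ≠ x := by
  classical
  by_contra! hx
  obtain ⟨g, hg⟩ := isBipartite_induce_iff.1 (hs.isBipartite_sdiff_singleton v hv)
  refine hs.not_isBipartite (isBipartite_induce_iff.2
    ⟨Function.update g v (g x + 1), fun u hu w hw huw => ?_⟩)
  by_cases huv : u = v
  · subst huv
    obtain rfl := hx w hw huw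
    simp [huw.ne']
  · by_cases hwv : w = v
    · subst hwv
      obtain rfl := hx u hu huw.symm
      simp [huv]
    · simpa [huv, hwv] using hg u ⟨hu, huv⟩ w ⟨hw, hwv⟩ huw

/-- The colour of a vertex of degree two may be chosen to conflict along one of its two edges
only. -/
theorem IsBipartiteCritical.exists_forall_ne_except_edge (hs : IsBipartiteCritical G s) {a b c : V}
    (ha : a ∈ s) (hb : b ∈ s) (hab : G.Adj a b) (hdeg : ∀ v ∈ s, G.Adj a v → v = b ∨ v = c) :
    ∃ g : V → ZMod 2, g a = g b ∧
      ∀ u ∈ s, ∀ v ∈ s, G.Adj u v → s(u, v) ≠ s(a, b) → g u ≠ g v := by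
  classical
  obtain ⟨g, hg⟩ := isBipartite_induce_iff.1 (hs.isBipartite_sdiff_singleton a ha)
  set g' := Function.update g a (g c + 1) with hg'
  have hproper : ∀ u ∈ s, ∀ v ∈ s, G.Adj u v → s(u, v) ≠ s(a, b) → g' u ≠ g' v := by
    intro u hu v hv huv hne
    by_cases hua : u = a
    · subst hua
      obtain rfl := (hdeg v hv huv).resolve_left fun h => hne (h ▸ rfl)
      simp [hg', huv.ne']
    · by_cases hva : v = a
      · subst hva
        obtain rfl := (hdeg u hu huv.symm).resolve_left fun h => hne (h ▸ Sym2.eq_swap)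
        simp [hg', hua]
      · simpa [hg', hua, hva] using hg u ⟨hu, hua⟩ v ⟨hv, hva⟩ huv
  refine ⟨g', by_contra fun hne => hs.not_isBipartite (isBipartite_induce_iff.2
    ⟨g', fun u hu v hv huv => ?_⟩), hproper⟩
  by_cases huvab : s(u, v) = s(a, b)
  · rcases Sym2.eq_iff.1 huvab with ⟨rfl, rfl⟩ | ⟨rfl, rfl⟩
    · exact hne
    · exact Ne.symm hne
  · exact hproper u hu v hv huv huvab

end GraphLemmas

/-! ### Colouring problems on subcubic trees -/

/-- A colouring problem on a signed graph in which, besides the edge constraints, every vertex has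
a list of forbidden colours and every pair of vertices a list of forbidden clashes. -/
structure ColoringProblem (V : Type*) extends SignedGraph V where
  forbidden : V → Finset Color
  clash : V → V → Finset (ZMod 2)
  clash_comm : ∀ u v, clash u v = clash v u
  clash_self : ∀ v, clash v v = ∅

namespace ColoringProblem

open scoped Classical

variable {V : Type*} {P : ColoringProblem V}

/-- The colouring `φ` satisfies all constraints that involve the vertex `v`. -/
structure IsSolutionAt (P : ColoringProblem V) (φ : V → Color) (v : V) : Prop where
  notMem_forbidden : φ v ∉ P.forbidden v
  compatible : ∀ u, P.graph.Adj v u → Compatible (P.sign v u) (φ v) (φ u)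
  not_clash : ∀ u, ∀ t ∈ P.clash v u, ¬ Clash t (φ v) (φ u)

/-- Some colouring satisfies all constraints. -/
def IsSolvable (P : ColoringProblem V) : Prop :=
  ∃ φ, ∀ v, P.IsSolutionAt φ v

/-- The problem on the vertices in `s`, with further forbidden colours `F` and clashes `D`. -/
def restrict (P : ColoringProblem V) (s : Set V) (F : V → Finset Color)
    (D : V → V → Finset (ZMod 2)) (hcomm : ∀ u v, D u v = D v u) (hself : ∀ v, D v v = ∅) :
    ColoringProblem s where
  graph := P.graph.induce s
  sign u v := P.sign u v
  sign_comm _ _ := P.sign_comm _ _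
  forbidden v := P.forbidden v ∪ F v
  clash u v := P.clash u v ∪ D u v
  clash_comm _ _ := by rw [P.clash_comm, hcomm]
  clash_self _ := by rw [P.clash_self, hself, Finset.empty_union]

theorem IsSolvable.of_restrict {s : Set V} {F : V → Finset Color} {D : V → V → Finset (ZMod 2)}
    {hcomm : ∀ u v, D u v = D v u} {hself : ∀ v, D v v = ∅}
    (h : (P.restrict s F D hcomm hself).IsSolvable)
    (hextend : ∀ φ : V → Color, (∀ v ∈ s, φ v ∉ F v) →
      (∀ u ∈ s, ∀ v ∈ s, ∀ t ∈ D u v, ¬ Clash t (φ u) (φ v)) →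
        ∃ ψ, Set.EqOn ψ φ s ∧ ∀ v ∉ s, P.IsSolutionAt ψ v) : P.IsSolvable := by
  obtain ⟨φ, hφ⟩ := h
  obtain ⟨ψ, hψφ, hψ⟩ := hextend (fun v => if hv : v ∈ s then φ ⟨v, hv⟩ else 0)
    (fun v hv hmem => (hφ ⟨v, hv⟩).notMem_forbidden
      (Finset.mem_union_right _ (by simpa [hv] using hmem)))
    (fun u hu v hv t ht hclash => (hφ ⟨u, hu⟩).not_clash ⟨v, hv⟩ t
      (Finset.mem_union_right _ ht) (by simpa [hu, hv] using hclash))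
  have heq : ∀ v (hv : v ∈ s), ψ v = φ ⟨v, hv⟩ := fun v hv => by simpa [hv] using hψφ hv
  refine ⟨ψ, fun v => ?_⟩
  by_cases hv : v ∈ s
  · have hφv := hφ ⟨v, hv⟩
    refine ⟨fun hmem => hφv.notMem_forbidden (Finset.mem_union_left _ (heq v hv ▸ hmem)),
      fun u huv => ?_, fun u t ht => ?_⟩ <;> by_cases hu : u ∈ s
    · rw [heq v hv, heq u hu]
      exact hφv.compatible ⟨u, hu⟩ huv
    · rw [P.sign_comm]
      exact ((hψ u hu).compatible v huv.symm).symm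
    · rw [heq v hv, heq u hu]
      exact hφv.not_clash ⟨u, hu⟩ t (Finset.mem_union_left _ ht)
    · exact fun hclash => (hψ u hu).not_clash v t (P.clash_comm v u ▸ ht) hclash.symm
  · exact hψ v hv

/-- The unsolvable problem: a star with centre `w` and leaves `u 0, u 1, u 2` in which any two
leaves clash with the sum of the signs of their edges. -/
structure IsExceptionalStar (P : ColoringProblem V) (w : V) (u : Fin 3 → V) : Prop where
  injective : Function.Injective u
  eq_or_eq : ∀ v, v = w ∨ ∃ i, v = u i
  adj : ∀ i, P.graph.Adj w (u i)
  clash_eq : ∀ i j, i ≠ j → P.clash (u i) (u j) = {P.sign w (u i) + P.sign w (u j)}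

variable [Fintype V]

/-- The number of clashes in which the vertex `v` takes part. -/
def numClashes (P : ColoringProblem V) (v : V) : ℕ :=
  ∑ u, (P.clash v u).card

/-- The graph is a tree, and every vertex has at most three constraints. -/
structure IsSubcubicTree (P : ColoringProblem V) : Prop where
  isTree : P.graph.IsTree
  degree_add_le : ∀ v, P.graph.degree v + (P.forbidden v).card + P.numClashes v ≤ 3

/-- Solving `P` reduces to solving a smaller problem of the same kind. The vertex with fewer than
three edges and clashes rules out that the smaller problem is the exceptional star. -/
def IsReducible (P : ColoringProblem V) : Prop :=
  ∃ (s : Set V) (Q : ColoringProblem s), s ≠ Set.univ ∧ Q.IsSubcubicTree ∧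
    (∃ v, Q.graph.degree v + Q.numClashes v < 3) ∧ (Q.IsSolvable → P.IsSolvable)

theorem card_clash_le_numClashes (P : ColoringProblem V) (v u : V) :
    (P.clash v u).card ≤ P.numClashes v :=
  Finset.single_le_sum (f := fun u => (P.clash v u).card) (by simp) (Finset.mem_univ u)

section Restrict

variable {s : Set V} {A : Finset V} {F : V → Finset Color} {D : V → V → Finset (ZMod 2)}
  {hcomm : ∀ u v, D u v = D v u} {hself : ∀ v, D v v = ∅}

theorem numClashes_restrict_le (hs : ∀ v, v ∈ s ↔ v ∉ A) (v : s) :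
    (P.restrict s F D hcomm hself).numClashes v + ∑ u ∈ A, (P.clash v u).card ≤
      P.numClashes v + ∑ u, (D v u).card := by
  have hle : (P.restrict s F D hcomm hself).numClashes v ≤
      ∑ u ∈ Aᶜ, ((P.clash v u).card + (D v u).card) := by
    rw [Finset.sum_subtype (p := (· ∈ s)) Aᶜ (by simp [hs])]
    exact Finset.sum_le_sum fun u _ => Finset.card_union_le _ _
  have hD : ∑ u ∈ Aᶜ, (D v u).card ≤ ∑ u, (D v u).card :=
    Finset.sum_le_sum_of_subset (Finset.subset_univ _)
  have hsplit := Finset.sum_add_sum_compl A fun u => (P.clash v u).card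
  rw [Finset.sum_add_distrib] at hle
  rw [numClashes.eq_1 P]
  omega

theorem degree_restrict (hs : ∀ v, v ∈ s ↔ v ∉ A) (v : s) :
    (P.restrict s F D hcomm hself).graph.degree v + (A.filter (P.graph.Adj v)).card =
      P.graph.degree v := by
  rw [restrict, degree_induce_eq_card_filter, ← SimpleGraph.card_neighborFinset_eq_degree,
    ← Finset.card_filter_add_card_filter_not (s := P.graph.neighborFinset v) (· ∉ A)]
  congr 2 <;> ext <;> simp [hs, and_comm]

/-- Leaves may be deleted at the cost of new constraints on the other vertices, as long as each of
these loses as many edges and clashes as it gets new constraints. -/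
theorem IsSubcubicTree.isReducible_of_leaves (h : P.IsSubcubicTree) (hA : A.Nonempty)
    (hleaf : ∀ v ∈ A, P.graph.degree v = 1) (F : V → Finset Color)
    (D : V → V → Finset (ZMod 2)) (hcomm : ∀ u v, D u v = D v u) (hself : ∀ v, D v v = ∅)
    (hload : ∀ v ∉ A, (F v).card + ∑ u, (D v u).card ≤
      (A.filter (P.graph.Adj v)).card + ∑ u ∈ A, (P.clash v u).card)
    (hlight : ∃ v ∉ A, ∑ u, (D v u).card <
      (A.filter (P.graph.Adj v)).card + ∑ u ∈ A, (P.clash v u).card)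
    (hextend : ∀ φ : V → Color, (∀ v ∉ A, φ v ∉ F v) →
      (∀ u ∉ A, ∀ v ∉ A, ∀ t ∈ D u v, ¬ Clash t (φ u) (φ v)) →
        ∃ ψ, (∀ v ∉ A, ψ v = φ v) ∧ ∀ v ∈ A, P.IsSolutionAt ψ v) : P.IsReducible := by
  obtain ⟨s, hs⟩ : ∃ s : Set V, ∀ v, v ∈ s ↔ v ∉ A := ⟨{v | v ∉ A}, fun _ => Iff.rfl⟩
  have hdegree := degree_restrict (P := P) (F := F) (hcomm := hcomm) (hself := hself) hs
  have hclashes := numClashes_restrict_le (P := P) (F := F) (hcomm := hcomm) (hself := hself) hs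
  obtain ⟨w, hw, hw_light⟩ := hlight
  have hws := (hs w).2 hw
  refine ⟨s, P.restrict s F D hcomm hself, ?_, ⟨?_, fun v => ?_⟩, ⟨⟨w, hws⟩, ?_⟩,
    fun hQ => hQ.of_restrict ?_⟩
  · rintro rfl
    obtain ⟨a, ha⟩ := hA
    exact (hs a).1 trivial ha
  · refine isTree_induce_of_neighborSet_subsingleton h.isTree ⟨w, hws⟩ fun v hv x hx y hy => ?_
    have hvA : v ∈ A := by simpa [hs] using hv
    exact (SimpleGraph.degree_eq_one_iff_existsUnique_adj.1 (hleaf v hvA)).unique hx hy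
  · have hforbidden : ((P.restrict s F D hcomm hself).forbidden v).card ≤ _ :=
      Finset.card_union_le (P.forbidden v) (F v)
    have := hdegree v
    have := hclashes v
    have := h.degree_add_le v
    have := hload v ((hs v).1 v.2)
    omega
  · have := hdegree ⟨w, hws⟩
    have := hclashes ⟨w, hws⟩
    have := h.degree_add_le w
    dsimp only at *
    omega
  · simpa [Set.EqOn, hs] using hextend

end Restrict

/-- The pairs of vertices that take part in a clash. -/
def clashGraph (P : ColoringProblem V) : SimpleGraph V where
  Adj u v := (P.clash u v).Nonempty
  symm := ⟨fun u v h => P.clash_comm u v ▸ h⟩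
  loopless := ⟨fun v h => by simp [P.clash_self] at h⟩

theorem isSolvable_of_subsingleton [Subsingleton V] (h : P.IsSubcubicTree) : P.IsSolvable := by
  have hfree : ∀ v, ∃ c, c ∉ P.forbidden v := fun v => by
    by_contra! hall
    have hcard := h.degree_add_le v
    rw [Finset.eq_univ_of_forall hall, Finset.card_univ, Fintype.card_prod, ZMod.card] at hcard
    omega
  choose φ hφ using hfree
  refine ⟨φ, fun v => ⟨hφ v, fun u huv => absurd (Subsingleton.elim v u) huv.ne,
    fun u t ht => ?_⟩⟩
  rw [Subsingleton.elim u v, P.clash_self] at ht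
  simp at ht

theorem IsSubcubicTree.isReducible_of_light_leaf (h : P.IsSubcubicTree) {v : V}
    (hv : P.graph.degree v = 1) (hlight : P.numClashes v ≤ 1) : P.IsReducible := by
  obtain ⟨w, hw, hw_unique⟩ := SimpleGraph.degree_eq_one_iff_existsUnique_adj.1 hv
  have hload := h.degree_add_le v
  obtain ⟨y, Z, hZ, hcolor⟩ := exists_forbidden_of_leaf (P.sign v w) (P.forbidden v) (P.clash v)
    hlight (by rw [← numClashes]; omega)
  have hw_filter : ({v} : Finset V).filter (P.graph.Adj w) = {v} := by
    simp [Finset.filter_singleton, hw.symm]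
  refine h.isReducible_of_leaves (A := {v}) (by simp) (by simpa using hv)
    (fun u => (if u = w then {y} else ∅) ∪ Z u) (fun _ _ => ∅) (by simp) (by simp)
    (fun u _ => ?_) ⟨w, by simpa using hw.ne', ?_⟩ fun φ hφ _ => ?_
  · have hunion := Finset.card_union_le (if u = w then {y} else ∅) (Z u)
    have hZu := hZ u
    rw [P.clash_comm] at hZu
    simp only [Finset.card_empty, Finset.sum_const_zero, Finset.sum_singleton]
    have hy : (if u = w then {y} else ∅ : Finset Color).card ≤
        (({v} : Finset V).filter (P.graph.Adj u)).card := by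
      split_ifs with huw
      · simp [huw, hw_filter]
      · simp
    omega
  · simp [hw_filter]
  · have hZv : Z v = ∅ := by simpa [P.clash_self] using hZ v
    obtain ⟨d, hd_notMem, hd_compat, hd_clash⟩ := hcolor (φ w)
      (fun hy => hφ w (by simpa using hw.ne') (by simp [hy])) φ fun u => by
        rcases eq_or_ne u v with rfl | huv
        · simp [hZv]
        · exact fun hu => hφ u (by simpa using huv) (Finset.mem_union_right _ hu)
    refine ⟨Function.update φ v d, fun u hu =>
      Function.update_of_ne (by simpa using hu) _ _, fun u hu => ?_⟩
    obtain rfl : u = v := by simpa using hu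
    refine ⟨by simpa using hd_notMem, fun x hx => ?_, fun x t ht => ?_⟩
    · obtain rfl := hw_unique x hx
      simpa [hx.ne'] using hd_compat
    · have hxu : x ≠ u := fun hxu => by simp [hxu, P.clash_self] at ht
      simpa [hxu] using hd_clash x t ht

/-- Since a vertex of a tree with more than one vertex has degree at least one, a vertex with both
a forbidden colour and a clash would be a leaf with too many constraints. -/
theorem IsSubcubicTree.clash_eq_empty_of_forbidden [Nontrivial V] (h : P.IsSubcubicTree)
    (hheavy : ∀ v, P.graph.degree v = 1 → 2 ≤ P.numClashes v) {v : V}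
    (hv : (P.forbidden v).Nonempty) (u : V) : P.clash v u = ∅ := by
  have hdegree := h.isTree.1.preconnected.degree_pos_of_nontrivial v
  have hforbidden := hv.card_pos
  have := h.degree_add_le v
  have := hheavy v
  have := P.card_clash_le_numClashes v u
  exact Finset.card_eq_zero.1 (by omega)

theorem IsSubcubicTree.card_forbidden_le_one [Nontrivial V] (h : P.IsSubcubicTree)
    (hheavy : ∀ v, P.graph.degree v = 1 → 2 ≤ P.numClashes v) (v : V) :
    (P.forbidden v).card ≤ 1 := by
  have hdegree := h.isTree.1.preconnected.degree_pos_of_nontrivial v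
  have := h.degree_add_le v
  have := hheavy v
  omega

/-- The first coordinates are chosen to avoid all clashes and forbidden colours; the second ones
can then be found along the tree. -/
theorem IsSubcubicTree.isSolvable_of_isBipartite_clashGraph [Nontrivial V]
    (h : P.IsSubcubicTree) (hheavy : ∀ v, P.graph.degree v = 1 → 2 ≤ P.numClashes v)
    (hbip : P.clashGraph.IsBipartite) : P.IsSolvable := by
  obtain ⟨g⟩ : Nonempty (P.clashGraph.Coloring (ZMod 2)) := hbip
  have hfirst : ∀ v, ∃ x : ZMod 2, (∀ f ∈ P.forbidden v, x ≠ f.1) ∧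
      (P.forbidden v = ∅ → x = g v) := fun v => by
    rcases (P.forbidden v).eq_empty_or_nonempty with hv | ⟨f, hf⟩
    · exact ⟨g v, by simp [hv], fun _ => rfl⟩
    · refine ⟨f.1 + 1, fun f' hf' => ?_, fun hv => by simp [hv] at hf⟩
      rw [Finset.card_le_one.1 (h.card_forbidden_le_one hheavy v) f' hf' f hf]
      simp
  choose X hX_ne hX_eq using hfirst
  obtain ⟨Y, hY⟩ := exists_forall_adj_add_eq_of_isTree h.isTree
    (τ := fun u v => P.sign u v + X u * X v) fun u v => by rw [P.sign_comm, mul_comm]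
  refine ⟨fun v => (X v, Y v), fun v => ⟨fun hv => hX_ne v _ hv rfl, fun u hvu => ?_,
    fun u t ht hclash => ?_⟩⟩
  · rw [Compatible, hY v u hvu, add_assoc, CharTwo.add_self_eq_zero, add_zero]
  · have hempty : ∀ x y, t ∈ P.clash x y → P.forbidden x = ∅ := fun x y hxy =>
      Finset.not_nonempty_iff_eq_empty.1 fun hx => by
        simp [h.clash_eq_empty_of_forbidden hheavy hx y] at hxy
    refine g.valid (v := v) (w := u) ⟨t, ht⟩ ?_
    rw [← hX_eq v (hempty v u ht), ← hX_eq u (hempty u v (P.clash_comm v u ▸ ht))]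
    exact hclash.1

theorem exists_clash_eq_singleton {v b c : V} (hv : P.numClashes v ≤ 2)
    (hb : P.clashGraph.Adj v b) (hc : P.clashGraph.Adj v c) (hbc : b ≠ c) :
    ∃ t, P.clash v b = {t} := by
  have hsum : ∑ u ∈ {b, c}, (P.clash v u).card ≤ P.numClashes v :=
    Finset.sum_le_sum_of_subset (Finset.subset_univ _)
  rw [Finset.sum_pair hbc] at hsum
  have hbpos := hb.card_pos
  have hcpos := hc.card_pos
  exact Finset.card_eq_one.1 (by omega)

theorem eq_or_eq_of_clashGraph_adj {v b c x : V} (hv : P.numClashes v ≤ 2)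
    (hb : P.clashGraph.Adj v b) (hc : P.clashGraph.Adj v c) (hbc : b ≠ c)
    (hx : P.clashGraph.Adj v x) : x = b ∨ x = c := by
  by_contra! hne
  have hsum : ∑ u ∈ {x, b, c}, (P.clash v u).card ≤ P.numClashes v :=
    Finset.sum_le_sum_of_subset (Finset.subset_univ _)
  rw [Finset.sum_insert (by simp [hne]), Finset.sum_pair hbc] at hsum
  have hbpos := hb.card_pos
  have hcpos := hc.card_pos
  have hxpos := hx.card_pos
  omega

theorem sum_card_ite_mk_eq {x y : V} (hxy : x ≠ y) (t : ZMod 2) (v : V) :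
    ∑ u, (if s(v, u) = s(x, y) then {t} else ∅ : Finset (ZMod 2)).card =
      if v = x ∨ v = y then 1 else 0 := by
  simp only [apply_ite Finset.card, Finset.card_singleton, Finset.card_empty]
  rcases eq_or_ne v x with rfl | hvx
  · simp [hxy]
  · rcases eq_or_ne v y with rfl | hvy
    · simp [hvx]
    · simp [hvx, hvy]

section CriticalClashes

variable {A : Finset V}

theorem two_le_numClashes_of_mem (hA : IsBipartiteCritical P.clashGraph (A : Set V)) {v : V}
    (hv : v ∈ A) : 2 ≤ P.numClashes v := by
  obtain ⟨b, -, hb, -⟩ := hA.exists_adj_ne hv v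
  obtain ⟨c, -, hc, hcb⟩ := hA.exists_adj_ne hv b
  have hsum : ∑ u ∈ {c, b}, (P.clash v u).card ≤ P.numClashes v :=
    Finset.sum_le_sum_of_subset (Finset.subset_univ _)
  rw [Finset.sum_pair hcb] at hsum
  have hbpos := hb.card_pos
  have hcpos := hc.card_pos
  omega

variable [Nontrivial V]

theorem IsSubcubicTree.degree_eq_one_of_mem (h : P.IsSubcubicTree)
    (hA : IsBipartiteCritical P.clashGraph (A : Set V)) {v : V} (hv : v ∈ A) :
    P.graph.degree v = 1 ∧ P.forbidden v = ∅ ∧ P.numClashes v = 2 := by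
  have hdegree := h.isTree.1.preconnected.degree_pos_of_nontrivial v
  have hclashes := two_le_numClashes_of_mem hA hv
  have := h.degree_add_le v
  exact ⟨by omega, Finset.card_eq_zero.1 (by omega), by omega⟩

theorem IsSubcubicTree.mem_of_clashGraph_adj (h : P.IsSubcubicTree)
    (hA : IsBipartiteCritical P.clashGraph (A : Set V)) {v u : V} (hv : v ∈ A)
    (hu : P.clashGraph.Adj v u) : u ∈ A := by
  obtain ⟨b, hbA, hb, -⟩ := hA.exists_adj_ne hv v
  obtain ⟨c, hcA, hc, hcb⟩ := hA.exists_adj_ne hv b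
  obtain rfl | rfl := eq_or_eq_of_clashGraph_adj (h.degree_eq_one_of_mem hA hv).2.2.le hc hb hcb hu
  exacts [hcA, hbA]

/-- Otherwise the tree would consist of `v` and `w`, but `v` clashes with two vertices. -/
theorem IsSubcubicTree.notMem_of_adj (h : P.IsSubcubicTree)
    (hA : IsBipartiteCritical P.clashGraph (A : Set V)) {v w : V} (hv : v ∈ A)
    (hvw : P.graph.Adj v w) : w ∉ A := by
  intro hw
  have hleaf : ∀ {x y z}, x ∈ A → P.graph.Adj x y → P.graph.Adj x z → y = z := fun hx hy hz =>
    (SimpleGraph.degree_eq_one_iff_existsUnique_adj.1 (h.degree_eq_one_of_mem hA hx).1).unique hy hz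
  have huniv : ({v, w} : Set V) = Set.univ := by
    refine eq_univ_of_forall_adj_mem h.isTree.1.preconnected ⟨v, by simp⟩ ?_
    rintro u (rfl | rfl) x hux
    · simp [hleaf hv hux hvw]
    · simp [hleaf hw hux hvw.symm]
  obtain ⟨u, -, hu, huw⟩ := hA.exists_adj_ne hv w
  have hmem : u ∈ ({v, w} : Set V) := huniv ▸ Set.mem_univ u
  obtain rfl | rfl := hmem
  exacts [hu.ne rfl, huw rfl]

/-- All vertices of `A` are coloured from their neighbours `p v`, with first coordinates that
alternate along all clashes except that of `a` and `b`. -/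
theorem IsSubcubicTree.exists_isSolutionAt_of_not_clash (h : P.IsSubcubicTree)
    (hA : IsBipartiteCritical P.clashGraph (A : Set V)) {p : V → V}
    (hp : ∀ v ∈ A, ∀ u, P.graph.Adj v u ↔ u = p v) {a b : V} {t : ZMod 2} (ha : a ∈ A)
    (hab : P.clash a b = {t}) {φ : V → Color}
    (hφ : ¬ Clash (t + P.sign a (p a) + P.sign b (p b)) (φ (p a)) (φ (p b))) :
    ∃ ψ, (∀ v ∉ A, ψ v = φ v) ∧ ∀ v ∈ A, P.IsSolutionAt ψ v := by
  have hadj : P.clashGraph.Adj a b := ⟨t, by simp [hab]⟩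
  have hb := h.mem_of_clashGraph_adj hA ha hadj
  obtain ⟨c, -, hc, hcb⟩ := hA.exists_adj_ne ha b
  obtain ⟨g, hgab, hg⟩ := hA.exists_forall_ne_except_edge ha hb hadj fun v _ hv =>
    eq_or_eq_of_clashGraph_adj (h.degree_eq_one_of_mem hA ha).2.2.le hadj hc hcb.symm hv
  obtain ⟨x, hx⟩ := exists_fst_not_clash hφ
  have hsame : ∀ {u v t'}, u ∈ A → v ∈ A → t' ∈ P.clash u v → g u = g v →
      t' = t ∧ s(u, v) = s(a, b) := fun {u v t'} hu hv ht' huv => by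
    have hedge := by_contra fun hne => hg u hu v hv ⟨t', ht'⟩ hne huv
    rcases Sym2.eq_iff.1 hedge with ⟨rfl, rfl⟩ | ⟨rfl, rfl⟩
    · exact ⟨by simpa [hab] using ht', hedge⟩
    · exact ⟨by simpa [P.clash_comm u v, hab] using ht', hedge⟩
  refine ⟨fun v => if v ∈ A then (g v + g a + x, P.sign v (p v) + (φ (p v)).2 +
    (g v + g a + x) * (φ (p v)).1) else φ v, fun v hv => if_neg hv, fun v hv => ⟨?_, ?_, ?_⟩⟩
  · simp [(h.degree_eq_one_of_mem hA hv).2.1]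
  · intro u hvu
    obtain rfl := (hp v hv u).1 hvu
    rw [if_pos hv, if_neg (h.notMem_of_adj hA hv hvu), Compatible]
    grind
  · intro u t' ht' hclash
    have hu := h.mem_of_clashGraph_adj hA hv ⟨t', ht'⟩
    rw [if_pos hv, if_pos hu] at hclash
    obtain ⟨rfl, hedge⟩ := hsame hv hu ht' (by simpa using hclash.1)
    have hga : g a + g a = 0 := CharTwo.add_self_eq_zero _
    refine hx (Eq.trans ?_ hclash.2)
    rcases Sym2.eq_iff.1 hedge with ⟨rfl, rfl⟩ | ⟨rfl, rfl⟩
    · rw [← hgab, hga]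
      ring
    · rw [← hgab, hga]
      ring

/-- After the deletion of the odd cycle `A` of clashing leaves, it is enough to prevent one clash of
two neighbours of `A`. -/
theorem IsSubcubicTree.isReducible_of_neighbor_ne (h : P.IsSubcubicTree)
    (hA : IsBipartiteCritical P.clashGraph (A : Set V)) {p : V → V}
    (hp : ∀ v ∈ A, ∀ u, P.graph.Adj v u ↔ u = p v) {a b c : V} (ha : a ∈ A)
    (hb : P.clashGraph.Adj a b) (hc : P.clashGraph.Adj a c) (hbc : b ≠ c) (hab : p a ≠ p b) :
    P.IsReducible := by
  have hbA := h.mem_of_clashGraph_adj hA ha hb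
  have hcA := h.mem_of_clashGraph_adj hA ha hc
  have hpA : ∀ v ∈ A, P.graph.Adj v (p v) := fun v hv => (hp v hv _).2 rfl
  have hmem_filter : ∀ {v w}, v ∈ A → p v = w → v ∈ A.filter (P.graph.Adj w) := fun hv hw =>
    Finset.mem_filter.2 ⟨hv, hw ▸ (hpA _ hv).symm⟩
  obtain ⟨t, ht⟩ := exists_clash_eq_singleton (h.degree_eq_one_of_mem hA ha).2.2.le hb hc hbc
  have hsum := sum_card_ite_mk_eq hab (t + P.sign a (p a) + P.sign b (p b))
  refine h.isReducible_of_leaves ⟨a, ha⟩ (fun v hv => (h.degree_eq_one_of_mem hA hv).1)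
    (fun _ => ∅) (fun u v => if s(u, v) = s(p a, p b) then
      {t + P.sign a (p a) + P.sign b (p b)} else ∅) (fun u v => by rw [Sym2.eq_swap])
    (fun v => if_neg fun hv => ?_) (fun v _ => ?_)
    ⟨p c, h.notMem_of_adj hA hcA (hpA c hcA), ?_⟩ fun φ _ hφ => ?_
  · rcases Sym2.eq_iff.1 hv with ⟨hva, hvb⟩ | ⟨hvb, hva⟩ <;> exact hab (hva.symm.trans hvb)
  · rw [hsum v, Finset.card_empty, zero_add]
    split_ifs with hv
    · refine le_add_right (Finset.card_pos.2 ?_)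
      rcases hv with rfl | rfl
      exacts [⟨a, hmem_filter ha rfl⟩, ⟨b, hmem_filter hbA rfl⟩]
    · exact Nat.zero_le _
  · rw [hsum (p c)]
    refine Nat.lt_add_right _ ?_
    split_ifs with hpc
    · rcases hpc with hpc | hpc
      · exact Finset.one_lt_card.2
          ⟨a, hmem_filter ha hpc.symm, c, hmem_filter hcA rfl, hc.ne⟩
      · exact Finset.one_lt_card.2
          ⟨b, hmem_filter hbA hpc.symm, c, hmem_filter hcA rfl, hbc⟩
    · exact Finset.card_pos.2 ⟨c, hmem_filter hcA rfl⟩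
  · exact h.exists_isSolutionAt_of_not_clash hA hp ha ht
      (hφ _ (h.notMem_of_adj hA ha (hpA a ha)) _ (h.notMem_of_adj hA hbA (hpA b hbA)) _ (by simp))

end CriticalClashes

section ExceptionalStar

variable {V : Type*} {P : ColoringProblem V}

/-- Two leaves whose clash is not forced to occur can have equal first coordinates. -/
theorem isSolvable_of_ne_add {w : V} {u : Fin 3 → V} (hinj : Function.Injective u)
    (hcover : ∀ v, v = w ∨ ∃ i, v = u i) (hadj : ∀ i v, P.graph.Adj (u i) v ↔ v = w)
    (hforbidden : ∀ v, P.forbidden v = ∅) (hcenter : ∀ v, P.clash w v = ∅) {i j : Fin 3}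
    (hij : i ≠ j) {t : ZMod 2} (hclash : P.clash (u i) (u j) = {t})
    (ht : t ≠ P.sign w (u i) + P.sign w (u j)) : P.IsSolvable := by
  have hw : ∀ k, u k ≠ w := fun k => ((hadj k w).2 rfl).ne
  have hclash_nonempty : ∀ {x y s}, s ∈ P.clash x y → ∃ k l, k ≠ l ∧ x = u k ∧ y = u l := by
    intro x y s hs
    obtain rfl | ⟨k, rfl⟩ := hcover x
    · simp [hcenter] at hs
    obtain rfl | ⟨l, rfl⟩ := hcover y
    · simp [P.clash_comm _ y, hcenter] at hs
    exact ⟨k, l, by rintro rfl; simp [P.clash_self] at hs, rfl, rfl⟩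
  refine ⟨fun v => if v = w then 0 else (if v = u i ∨ v = u j then 0 else 1, P.sign w v),
    fun v => ⟨by simp [hforbidden], fun x hvx => ?_, fun x s hs hclash' => ?_⟩⟩
  · obtain rfl | ⟨k, rfl⟩ := hcover v
    · simp [Compatible, hvx.ne']
    · obtain rfl := (hadj k x).1 hvx
      simp [Compatible, hw, P.sign_comm]
  · obtain ⟨k, l, hkl, rfl, rfl⟩ := hclash_nonempty hs
    simp only [hw, if_false, hinj.eq_iff] at hclash'
    have hiff : (k = i ∨ k = j) ↔ (l = i ∨ l = j) := by
      have hfst := hclash'.1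
      split_ifs at hfst <;> simp_all
    have hpair : (k = i ∧ l = j) ∨ (k = j ∧ l = i) := by omega
    have hsum : P.sign w (u k) + P.sign w (u l) = s := hclash'.2
    rcases hpair with ⟨rfl, rfl⟩ | ⟨rfl, rfl⟩
    · exact ht (by simpa [hclash, hsum, eq_comm] using hs)
    · exact ht (by simpa [P.clash_comm (u k), hclash, hsum, add_comm, eq_comm] using hs)

theorem isSolvable_or_isExceptionalStar {w : V} {u : Fin 3 → V} (hinj : Function.Injective u)
    (hcover : ∀ v, v = w ∨ ∃ i, v = u i) (hadj : ∀ i v, P.graph.Adj (u i) v ↔ v = w)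
    (hforbidden : ∀ v, P.forbidden v = ∅) (hcenter : ∀ v, P.clash w v = ∅)
    (hclash : ∀ i j, i ≠ j → ∃ t, P.clash (u i) (u j) = {t}) :
    P.IsSolvable ∨ P.IsExceptionalStar w u := by
  by_cases h : ∀ i j, i ≠ j → P.clash (u i) (u j) = {P.sign w (u i) + P.sign w (u j)}
  · exact .inr ⟨hinj, hcover, fun i => ((hadj i w).2 rfl).symm, h⟩
  · push Not at h
    obtain ⟨i, j, hij, hne⟩ := h
    obtain ⟨t, ht⟩ := hclash i j hij
    exact .inl (isSolvable_of_ne_add hinj hcover hadj hforbidden hcenter hij ht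
      fun htij => hne (htij ▸ ht))

variable [Fintype V]

theorem IsSubcubicTree.eq_and_forbidden_eq_and_clash_eq_of_three_adj (h : P.IsSubcubicTree) {w : V}
    {u : Fin 3 → V} (hinj : Function.Injective u) (hadj : ∀ i, P.graph.Adj w (u i)) :
    (∀ v, P.graph.Adj w v → ∃ i, v = u i) ∧ P.forbidden w = ∅ ∧ ∀ v, P.clash w v = ∅ := by
  have hsubset : Finset.univ.image u ⊆ P.graph.neighborFinset w := by
    simpa [Finset.subset_iff] using hadj
  have hcard : (Finset.univ.image u).card = 3 := by
    rw [Finset.card_image_of_injective _ hinj, Finset.card_univ, Fintype.card_fin]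
  have hle := Finset.card_le_card hsubset
  have hload := h.degree_add_le w
  rw [← SimpleGraph.card_neighborFinset_eq_degree] at hload
  refine ⟨fun v hv => ?_, Finset.card_eq_zero.1 (by omega), fun v => ?_⟩
  · have heq := Finset.eq_of_subset_of_card_le hsubset (by omega)
    have hmem : v ∈ Finset.univ.image u := heq ▸ (P.graph.mem_neighborFinset w v).2 hv
    simpa [eq_comm] using hmem
  · have hclash := P.card_clash_le_numClashes w v
    exact Finset.card_eq_zero.1 (by omega)

variable {A : Finset V} {p : V → V}

theorem IsSubcubicTree.exists_clash_triangle_of_neighbor_eq (h : P.IsSubcubicTree)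
    (hA : IsBipartiteCritical P.clashGraph (A : Set V))
    (hp : ∀ v ∈ A, ∀ u, P.graph.Adj v u ↔ u = p v)
    (heq : ∀ u ∈ A, ∀ v ∈ A, P.clashGraph.Adj u v → p u = p v) :
    ∃ (w : V) (u : Fin 3 → V), (∀ i, u i ∈ A) ∧ (∀ i, p (u i) = w) ∧
      ∀ i j, i ≠ j → P.clashGraph.Adj (u i) (u j) := by
  obtain ⟨a, ha⟩ := hA.nonempty
  obtain ⟨b, hb, hab, -⟩ := hA.exists_adj_ne ha a
  obtain ⟨c, hc, hac, hcb⟩ := hA.exists_adj_ne ha b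
  obtain ⟨d, hd, hbd, hda⟩ := hA.exists_adj_ne hb a
  have hpb := heq a ha b hb hab
  have hpc := heq a ha c hc hac
  have hpd := hpb.trans (heq b hb d hd hbd)
  have hadj : ∀ v ∈ A, p a = p v → P.graph.Adj (p a) v := fun v hv hpv =>
    ((hp v hv _).2 hpv).symm
  have hinj : Function.Injective ![a, b, c] := by
    intro i j
    fin_cases i <;> fin_cases j <;> simp [hab.ne, hab.ne', hac.ne, hac.ne', hcb, hcb.symm]
  obtain ⟨hneighbors, -, -⟩ := h.eq_and_forbidden_eq_and_clash_eq_of_three_adj hinj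
    (w := p a) (by
      simpa [Fin.forall_fin_succ] using ⟨hadj a ha rfl, hadj b hb hpb, hadj c hc hpc⟩)
  obtain rfl : d = c := by
    simpa [Fin.exists_fin_succ, hda, hbd.ne'] using hneighbors d (hadj d hd hpd)
  refine ⟨p a, ![a, b, d], ?_, ?_, fun i j hij => ?_⟩
  · simpa [Fin.forall_fin_succ] using ⟨ha, hb, hd⟩
  · simp [Fin.forall_fin_succ, ← hpb, ← hpd]
  · fin_cases i <;> fin_cases j <;> simp_all [SimpleGraph.adj_comm]

/-- If all clashing leaves have the same neighbour, then this neighbour and three of them are the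
whole tree. -/
theorem IsSubcubicTree.isSolvable_or_exists_isExceptionalStar_of_neighbor_eq [Nontrivial V]
    (h : P.IsSubcubicTree) (hA : IsBipartiteCritical P.clashGraph (A : Set V))
    (hp : ∀ v ∈ A, ∀ u, P.graph.Adj v u ↔ u = p v)
    (heq : ∀ u ∈ A, ∀ v ∈ A, P.clashGraph.Adj u v → p u = p v) :
    P.IsSolvable ∨ ∃ w u, P.IsExceptionalStar w u := by
  obtain ⟨w, u, huA, hpu, hclash⟩ := h.exists_clash_triangle_of_neighbor_eq hA hp heq
  have hinj : Function.Injective u := fun i j hij => by_contra fun hne => (hclash i j hne).ne hij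
  have hadj : ∀ i v, P.graph.Adj (u i) v ↔ v = w := fun i v => hpu i ▸ hp (u i) (huA i) v
  obtain ⟨hneighbors, hforbidden, hcenter⟩ := h.eq_and_forbidden_eq_and_clash_eq_of_three_adj hinj
    fun i => ((hadj i w).2 rfl).symm
  have huniv : insert w (Set.range u) = Set.univ := by
    refine eq_univ_of_forall_adj_mem h.isTree.1.preconnected ⟨w, by simp⟩ ?_
    rintro x (rfl | ⟨i, rfl⟩) y hxy
    · obtain ⟨i, rfl⟩ := hneighbors y hxy
      simp
    · simp [(hadj i y).1 hxy]
  have hcover : ∀ v, v = w ∨ ∃ i, v = u i := fun v => by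
    have hv : v ∈ insert w (Set.range u) := huniv ▸ Set.mem_univ v
    simpa [eq_comm] using hv
  refine (isSolvable_or_isExceptionalStar hinj hcover hadj (fun v => ?_) hcenter
    fun i j hij => ?_).imp_right fun hstar => ⟨w, u, hstar⟩
  · obtain rfl | ⟨i, rfl⟩ := hcover v
    exacts [hforbidden, (h.degree_eq_one_of_mem hA (huA i)).2.1]
  · obtain ⟨k, hki, hkj⟩ : ∃ k, k ≠ i ∧ k ≠ j := by
      revert i j
      decide
    exact exists_clash_eq_singleton (h.degree_eq_one_of_mem hA (huA i)).2.2.le (hclash i j hij)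
      (hclash i k hki.symm) (hinj.ne hkj.symm)

theorem IsSubcubicTree.isSolvable_or_exists_isExceptionalStar_or_isReducible
    (h : P.IsSubcubicTree) :
    P.IsSolvable ∨ (∃ w u, P.IsExceptionalStar w u) ∨ P.IsReducible := by
  rcases subsingleton_or_nontrivial V with hV | hV
  · exact .inl (isSolvable_of_subsingleton h)
  by_cases hlight : ∃ v, P.graph.degree v = 1 ∧ P.numClashes v ≤ 1
  · obtain ⟨v, hv, hv_light⟩ := hlight
    exact .inr (.inr (h.isReducible_of_light_leaf hv hv_light))
  push Not at hlight
  by_cases hbip : P.clashGraph.IsBipartite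
  · exact .inl (h.isSolvable_of_isBipartite_clashGraph hlight hbip)
  obtain ⟨s, hs⟩ := exists_isBipartiteCritical hbip
  obtain ⟨A, rfl⟩ : ∃ A : Finset V, (A : Set V) = s := ⟨s.toFinset, by simp⟩
  have hparent : ∀ v, ∃ w, v ∈ A → ∀ u, P.graph.Adj v u ↔ u = w := fun v => by
    by_cases hv : v ∈ A
    · obtain ⟨w, hw, hw_unique⟩ := SimpleGraph.degree_eq_one_iff_existsUnique_adj.1
        (h.degree_eq_one_of_mem hs hv).1
      exact ⟨w, fun _ u => ⟨hw_unique u, by rintro rfl; exact hw⟩⟩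
    · exact ⟨v, fun h => absurd h hv⟩
  choose p hp using hparent
  by_cases heq : ∀ u ∈ A, ∀ v ∈ A, P.clashGraph.Adj u v → p u = p v
  · exact (h.isSolvable_or_exists_isExceptionalStar_of_neighbor_eq hs hp heq).imp_right .inl
  · push Not at heq
    obtain ⟨a, ha, b, -, hab, hne⟩ := heq
    obtain ⟨c, -, hac, hcb⟩ := hs.exists_adj_ne ha b
    exact .inr (.inr (h.isReducible_of_neighbor_ne hs hp ha hab hac hcb.symm hne))

theorem IsExceptionalStar.three_le_degree_add_numClashes {w : V} {u : Fin 3 → V}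
    (h : P.IsExceptionalStar w u) (v : V) : 3 ≤ P.graph.degree v + P.numClashes v := by
  have hw : w ∉ Finset.univ.image u := by simpa using fun i => (h.adj i).ne'
  have hmem : v ∈ insert w (Finset.univ.image u) := by
    simpa [eq_comm] using h.eq_or_eq v
  calc 3 = ((insert w (Finset.univ.image u)).erase v).card := by
        rw [Finset.card_erase_of_mem hmem, Finset.card_insert_of_notMem hw,
          Finset.card_image_of_injective _ h.injective]
        simp
    _ ≤ ∑ x ∈ (insert w (Finset.univ.image u)).erase v,
          ((if P.graph.Adj v x then 1 else 0) + (P.clash v x).card) := by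
        rw [Finset.card_eq_sum_ones]
        refine Finset.sum_le_sum fun x hx => ?_
        obtain ⟨hxv, -⟩ := Finset.mem_erase.1 hx
        obtain rfl | ⟨i, rfl⟩ := h.eq_or_eq v
        · obtain ⟨j, rfl⟩ := (h.eq_or_eq x).resolve_left hxv
          simp [h.adj]
        · obtain rfl | ⟨j, rfl⟩ := h.eq_or_eq x
          · simp [(h.adj i).symm]
          · simp [h.clash_eq i j (by rintro rfl; exact hxv rfl)]
    _ ≤ ∑ x, ((if P.graph.Adj v x then 1 else 0) + (P.clash v x).card) :=
        Finset.sum_le_sum_of_subset (Finset.subset_univ _)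
    _ = P.graph.degree v + P.numClashes v := by
        rw [Finset.sum_add_distrib, numClashes, ← SimpleGraph.card_neighborFinset_eq_degree,
          SimpleGraph.neighborFinset_eq_filter, Finset.card_filter]

theorem IsSubcubicTree.isSolvable_or_exists_isExceptionalStar (h : P.IsSubcubicTree) :
    P.IsSolvable ∨ ∃ w u, P.IsExceptionalStar w u := by
  induction hn : Fintype.card V using Nat.strong_induction_on generalizing V with
  | _ n ih =>
  rcases h.isSolvable_or_exists_isExceptionalStar_or_isReducible with hP | hP |
    ⟨s, Q, hs, hQ, ⟨v, hv⟩, hPQ⟩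
  · exact .inl hP
  · exact .inr hP
  · obtain ⟨x, hx⟩ := (Set.ne_univ_iff_exists_notMem s).1 hs
    rcases ih _ (hn ▸ Fintype.card_subtype_lt hx) hQ rfl with hsol | ⟨w, u, hstar⟩
    · exact .inl (hPQ hsol)
    · exact absurd (hstar.three_le_degree_add_numClashes v) (by omega)

end ExceptionalStar

end ColoringProblem

/-! ### Discharging -/

section TreeComponents

open scoped Classical

variable {V : Type*} {G : SimpleGraph V}

/-- The graph of the edges between vertices of degree different from two. It is a graph on all
vertices; those of degree two become isolated. -/
def branchGraph [Fintype V] (G : SimpleGraph V) : SimpleGraph V where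
  Adj u v := G.Adj u v ∧ G.degree u ≠ 2 ∧ G.degree v ≠ 2
  symm := ⟨fun _ _ h => ⟨h.1.symm, h.2.2, h.2.1⟩⟩
  loopless := ⟨fun _ h => h.1.ne rfl⟩

variable [Fintype V]

theorem branchGraph_adj {u v : V} :
    (branchGraph G).Adj u v ↔ G.Adj u v ∧ G.degree u ≠ 2 ∧ G.degree v ≠ 2 := Iff.rfl

theorem sum_degree_connectedComponent (c : G.ConnectedComponent) :
    ∑ v with v ∈ c.supp, G.degree v = 2 * (G.induce c.supp).edgeFinset.card := by
  rw [← SimpleGraph.sum_degrees_eq_twice_card_edges, Finset.sum_subtype (p := (· ∈ c.supp)) _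
    (by simp)]
  refine Finset.sum_congr rfl fun v _ => ?_
  rw [degree_induce_eq_card_filter, ← SimpleGraph.card_neighborFinset_eq_degree]
  congr 1
  ext u
  simpa using fun huv => c.mem_supp_of_adj_mem_supp v.2 huv

/-- The charge of a vertex of degree other than two after discharging: a vertex of degree `d` has
charge `8 - 3 * d`, and every vertex of degree two sends half of its charge to each neighbour. -/
noncomputable def branchCharge (G : SimpleGraph V) (v : V) : ℤ :=
  8 - 2 * G.degree v - (branchGraph G).degree v

theorem sum_degree_filter_ne_two
    (hindep : ∀ u v, G.degree u = 2 → G.degree v = 2 → ¬ G.Adj u v) :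
    ∑ v with G.degree v ≠ 2, G.degree v =
      ∑ v with G.degree v ≠ 2, (branchGraph G).degree v +
        2 * ({v | G.degree v = 2} : Finset V).card := by
  set big : Finset V := {v | G.degree v ≠ 2} with hbig
  set small : Finset V := {v | G.degree v = 2} with hsmall
  have hdegree_big : ∀ v ∈ big,
      G.degree v = (branchGraph G).degree v + (small.bipartiteAbove G.Adj v).card := by
    intro v hv
    have hv' : G.degree v ≠ 2 := by simpa [hbig] using hv
    rw [← SimpleGraph.card_neighborFinset_eq_degree G,
      ← SimpleGraph.card_neighborFinset_eq_degree (branchGraph G),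
      ← Finset.card_filter_add_card_filter_not (fun u => G.degree u ≠ 2)]
    congr 2 <;> ext u
    · simp [branchGraph_adj, hv']
    · simp [hsmall, and_comm]
  have hdegree_small : ∀ v ∈ small, (big.bipartiteBelow G.Adj v).card = 2 := by
    intro v hv
    have hv' : G.degree v = 2 := by simpa [hsmall] using hv
    rw [← hv', ← SimpleGraph.card_neighborFinset_eq_degree]
    congr 1
    ext u
    simpa [hbig, G.adj_comm u] using fun huv hu => hindep v u hv' hu huv
  have hdouble := Finset.sum_card_bipartiteAbove_eq_sum_card_bipartiteBelow
    (s := big) (t := small) G.Adj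
  rw [Finset.sum_congr rfl hdegree_small, Finset.sum_const, smul_eq_mul] at hdouble
  rw [Finset.sum_congr rfl hdegree_big, Finset.sum_add_distrib, hdouble, mul_comm]

theorem sum_branchCharge (hindep : ∀ u v, G.degree u = 2 → G.degree v = 2 → ¬ G.Adj u v) :
    ∑ v with G.degree v ≠ 2, branchCharge G v =
      8 * Fintype.card V - 3 * ∑ v, G.degree v := by
  have hsum_big := sum_degree_filter_ne_two hindep
  have hsum := Finset.sum_filter_add_sum_filter_not Finset.univ (fun v => G.degree v = 2)
    fun v => G.degree v
  have hcard := Finset.card_filter_add_card_filter_not (s := Finset.univ) fun v => G.degree v = 2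
  have hsum_small : ∑ v with G.degree v = 2, G.degree v =
      ({v | G.degree v = 2} : Finset V).card * 2 := by
    rw [Finset.sum_congr rfl fun v hv => (Finset.mem_filter.1 hv).2, Finset.sum_const, smul_eq_mul]
  rw [← hsum, ← Finset.card_univ, ← hcard]
  push_cast
  simp only [branchCharge]
  rw [Finset.sum_sub_distrib, Finset.sum_sub_distrib, Finset.sum_const, ← Finset.mul_sum]
  have hsum_big_int := congrArg (Nat.cast : ℕ → ℤ) hsum_big
  have hsum_small_int := congrArg (Nat.cast : ℕ → ℤ) hsum_small
  simp only [Nat.cast_sum, Nat.cast_add, Nat.cast_mul, Nat.cast_ofNat]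
    at hsum_big_int hsum_small_int
  simp only [nsmul_eq_mul, ← ne_eq]
  linarith

theorem degree_ne_two_of_mem_supp {c : (branchGraph G).ConnectedComponent} {u v : V}
    (hu : u ∈ c.supp) (hv : v ∈ c.supp) (hdeg : G.degree v ≠ 2) : G.degree u ≠ 2 := by
  obtain ⟨p⟩ := c.reachable_of_mem_supp hu hv
  cases p with
  | nil => exact hdeg
  | cons huw _ => exact huw.2.1

theorem exists_connectedComponent_sum_branchCharge_pos
    (hindep : ∀ u v, G.degree u = 2 → G.degree v = 2 → ¬ G.Adj u v)
    (hsum : 3 * ∑ v, G.degree v < 8 * Fintype.card V) :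
    ∃ c : (branchGraph G).ConnectedComponent, (∀ v ∈ c.supp, G.degree v ≠ 2) ∧
      0 < ∑ v with v ∈ c.supp, branchCharge G v := by
  have hpos : 0 < ∑ v with G.degree v ≠ 2, branchCharge G v := by
    rw [sum_branchCharge hindep]
    zify at hsum
    push_cast
    linarith
  rw [← Finset.sum_fiberwise _ (branchGraph G).connectedComponentMk] at hpos
  obtain ⟨c, hc⟩ : ∃ c, 0 < ∑ v ∈ {v | G.degree v ≠ 2} with
      (branchGraph G).connectedComponentMk v = c, branchCharge G v := by
    by_contra! hnonpos
    exact hpos.not_ge (Finset.sum_nonpos fun c _ => hnonpos c)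
  obtain ⟨v, hv, -⟩ := Finset.exists_ne_zero_of_sum_ne_zero hc.ne'
  rw [Finset.filter_filter, Finset.mem_filter] at hv
  have hbranch : ∀ u ∈ c.supp, G.degree u ≠ 2 := fun u hu =>
    degree_ne_two_of_mem_supp hu hv.2.2 hv.2.1
  refine ⟨c, hbranch, ?_⟩
  convert hc using 2
  ext u
  simpa using hbranch u

theorem exists_isTree_induce_of_sum_degree_lt (hdeg : ∀ v, 2 ≤ G.degree v)
    (hindep : ∀ u v, G.degree u = 2 → G.degree v = 2 → ¬ G.Adj u v)
    (hsum : 3 * ∑ v, G.degree v < 8 * Fintype.card V) :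
    ∃ K : Set V, (G.induce K).IsTree ∧ (∀ v ∈ K, G.degree v = 3) ∧
      ∀ u ∈ K, ∀ v ∉ K, G.Adj u v → G.degree v = 2 := by
  obtain ⟨c, hbranch, hpos⟩ := exists_connectedComponent_sum_branchCharge_pos hindep hsum
  have hconn : ((branchGraph G).induce c.supp).Connected := c.connected_toSimpleGraph
  have hinduce : (branchGraph G).induce c.supp = G.induce c.supp := by
    ext u v
    simp [branchGraph_adj, hbranch u u.2, hbranch v v.2]
  have hthree : ∀ v ∈ ({v | v ∈ c.supp} : Finset V), 3 ≤ G.degree v := fun v hv => by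
    have := hbranch v (by simpa using hv)
    have := hdeg v
    omega
  have hedges := sum_degree_connectedComponent c
  have hcard := hconn.card_vert_le_card_edgeSet_add_one
  rw [Nat.card_eq_fintype_card, Nat.card_eq_fintype_card, ← SimpleGraph.edgeFinset_card,
    Fintype.card_subtype] at hcard
  have hsum_three := Finset.sum_le_sum hthree
  rw [Finset.sum_const, smul_eq_mul] at hsum_three
  simp only [branchCharge] at hpos
  rw [Finset.sum_sub_distrib, Finset.sum_sub_distrib, ← Finset.mul_sum, Finset.sum_const,
    nsmul_eq_mul, ← Nat.cast_sum, ← Nat.cast_sum, hedges] at hpos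
  have hdegree : ∀ v ∈ c.supp, G.degree v = 3 := fun v hv => by
    refine ((Finset.sum_eq_sum_iff_of_le hthree).1 ?_ v (by simpa using hv)).symm
    rw [Finset.sum_const, smul_eq_mul]
    omega
  refine ⟨c.supp, ?_, hdegree, fun u hu v hv huv => by_contra fun hv_branch =>
    hv (c.mem_supp_of_adj_mem_supp hu ⟨huv, hbranch u hu, hv_branch⟩)⟩
  rw [← hinduce, SimpleGraph.isTree_iff_connected_and_card, Nat.card_eq_fintype_card,
    Nat.card_eq_fintype_card, ← SimpleGraph.edgeFinset_card, Fintype.card_subtype]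
  exact ⟨hconn, by omega⟩

end TreeComponents

/-! ### Critical signed graphs -/

namespace SignedGraph

open scoped Classical

variable {V : Type*} {G : SignedGraph V} {φ : V → Color} {A : Set V}

/-- The colouring `φ` is correct on all edges between vertices in `A`. -/
def IsColoringOn (G : SignedGraph V) (φ : V → Color) (A : Set V) : Prop :=
  ∀ u ∈ A, ∀ v ∈ A, G.graph.Adj u v → Compatible (G.sign u v) (φ u) (φ v)

/-- The subgraph induced by `A` has a correct colouring. -/
def ColorableOn (G : SignedGraph V) (A : Set V) : Prop :=
  ∃ φ, G.IsColoringOn φ A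

/-- The signed graph is not colourable, but all its proper induced subgraphs are. -/
structure IsCritical (G : SignedGraph V) : Prop where
  not_colorableOn_univ : ¬ G.ColorableOn Set.univ
  colorableOn : ∀ A ≠ Set.univ, G.ColorableOn A

theorem IsColoringOn.update_insert (h : G.IsColoringOn φ A) {v : V} {d : Color}
    (hd : ∀ u ∈ A, G.graph.Adj v u → Compatible (G.sign v u) d (φ u)) :
    G.IsColoringOn (Function.update φ v d) (insert v A) := by
  have hv : ∀ x ∈ insert v A, G.graph.Adj v x →
      Compatible (G.sign v x) d (Function.update φ v d x) := fun x hx hvx => by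
    rw [Function.update_of_ne hvx.ne']
    exact hd x (hx.resolve_left hvx.ne') hvx
  intro x hx y hy hxy
  rcases eq_or_ne x v with rfl | hxv
  · simpa using hv y hy hxy
  rcases eq_or_ne y v with rfl | hyv
  · simpa [G.sign_comm x] using (hv x hx hxy.symm).symm
  simpa [hxv, hyv] using h x (hx.resolve_left hxv) y (hy.resolve_left hyv) hxy

variable [Fintype V]

theorem IsCritical.two_le_degree (h : G.IsCritical) (v : V) : 2 ≤ G.graph.degree v := by
  by_contra! hlt
  have : Nonempty V := ⟨v⟩
  rw [← SimpleGraph.card_neighborFinset_eq_degree] at hlt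
  obtain ⟨w, hw⟩ := Finset.card_le_one_iff_subset_singleton.1 (Nat.le_of_lt_succ hlt)
  obtain ⟨φ, hφ⟩ := h.colorableOn {v}ᶜ (by simp)
  obtain ⟨d, hd⟩ := exists_compatible (G.sign v w) (φ w)
  refine h.not_colorableOn_univ ⟨Function.update φ v d, ?_⟩
  convert hφ.update_insert (v := v) (d := d) fun u _ hvu => ?_
  · simp [Set.insert_eq]
  · obtain rfl : u = w := by simpa using hw ((G.graph.mem_neighborFinset v u).2 hvu)
    exact hd

theorem IsCritical.not_adj_of_degree_eq_two (h : G.IsCritical) {u v : V}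
    (hu : G.graph.degree u = 2) (hv : G.graph.degree v = 2) : ¬ G.graph.Adj u v := by
  intro huv
  obtain ⟨a, -, -, ha⟩ := exists_eq_or_eq_of_degree_eq_two hu huv
  obtain ⟨b, -, -, hb⟩ := exists_eq_or_eq_of_degree_eq_two hv huv.symm
  obtain ⟨φ, hφ⟩ := h.colorableOn {v, u}ᶜ ((Set.ne_univ_iff_exists_notMem _).2 ⟨v, by simp⟩)
  obtain ⟨d, d', hda, hdd', hd'b⟩ :=
    exists_compatible_path (G.sign u a) (G.sign u v) (G.sign v b) (φ a) (φ b)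
  have hcolor_u := hφ.update_insert (v := u) (d := d) fun x hx hux => by
    obtain rfl := (ha x hux).resolve_left fun hxv => hx (by simp [hxv])
    exact hda
  have hcolor_v := hcolor_u.update_insert (v := v) (d := d') fun x _ hvx => by
    rcases eq_or_ne x u with rfl | hxu
    · simpa [G.sign_comm v] using hdd'.symm
    · obtain rfl := (hb x hvx).resolve_left hxu
      simpa [hxu] using hd'b
  have hcover : insert v (insert u ({v, u}ᶜ : Set V)) = Set.univ := by
    rw [← Set.singleton_union, ← Set.singleton_union, ← Set.union_assoc, Set.singleton_union,
      Set.union_compl_self]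
  exact h.not_colorableOn_univ ⟨_, hcover ▸ hcolor_v⟩

section ResidualProblem

/-- The vertices of degree two with neighbours `u` and `v`. -/
noncomputable def midpoints (G : SignedGraph V) (u v : V) : Finset V :=
  {m | u ≠ v ∧ G.graph.degree m = 2 ∧ G.graph.Adj m u ∧ G.graph.Adj m v}

theorem mem_midpoints {u v m : V} : m ∈ G.midpoints u v ↔
    u ≠ v ∧ G.graph.degree m = 2 ∧ G.graph.Adj m u ∧ G.graph.Adj m v := by
  simp [midpoints]

theorem midpoints_comm (u v : V) : G.midpoints u v = G.midpoints v u := by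
  ext m
  simp only [mem_midpoints]
  tauto

theorem sum_card_midpoints_le (v : V) :
    ∑ u, (G.midpoints v u).card ≤ {m | G.graph.degree m = 2 ∧ G.graph.Adj v m}.toFinset.card := by
  rw [← Finset.card_biUnion]
  · refine Finset.card_le_card fun m hm => ?_
    obtain ⟨u, -, hu⟩ := Finset.mem_biUnion.1 hm
    obtain ⟨-, hdeg, hmv, -⟩ := mem_midpoints.1 hu
    simpa using ⟨hdeg, hmv.symm⟩
  · refine fun u _ u' _ huu' => Finset.disjoint_left.2 fun m hm hm' => huu' ?_
    obtain ⟨hvu, hdeg, hmv, hmu⟩ := mem_midpoints.1 hm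
    obtain ⟨hvu', -, -, hmu'⟩ := mem_midpoints.1 hm'
    obtain ⟨y, -, -, hy⟩ := exists_eq_or_eq_of_degree_eq_two hdeg hmv
    rw [(hy u hmu).resolve_left hvu.symm, (hy u' hmu').resolve_left hvu'.symm]

/-- The problem of recolouring the vertices in `K` when the vertices of degree two are coloured
last and all other vertices outside `K` keep their colour under `φ`. -/
noncomputable def residualProblem (G : SignedGraph V) (φ : V → Color) (K : Set V) :
    ColoringProblem K where
  graph := G.graph.induce K
  sign u v := G.sign u v
  sign_comm _ _ := G.sign_comm _ _
  forbidden v := {u | u ∉ K}.toFinset.biUnion fun u =>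
    (G.midpoints v u).image fun m => ((φ u).1, (φ u).2 + (G.sign m v + G.sign m u + 1))
  clash u v := (G.midpoints u v).image fun m => G.sign m u + G.sign m v + 1
  clash_comm u v := by
    rw [midpoints_comm]
    exact Finset.image_congr fun m _ => by rw [add_comm (G.sign m u)]
  clash_self v := by
    rw [Finset.image_eq_empty]
    ext m
    simp [mem_midpoints]

theorem isSubcubicTree_residualProblem {K : Set V} (φ : V → Color)
    (htree : (G.graph.induce K).IsTree) (hdeg : ∀ v ∈ K, G.graph.degree v = 3) :
    (G.residualProblem φ K).IsSubcubicTree := by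
  refine ⟨htree, fun v => ?_⟩
  have hforbidden : ((G.residualProblem φ K).forbidden v).card ≤
      ∑ u with u ∉ K, (G.midpoints v u).card := by
    refine Finset.card_biUnion_le.trans ?_
    rw [Set.toFinset_ofPred]
    exact Finset.sum_le_sum fun u _ => Finset.card_image_le
  have hclash : (G.residualProblem φ K).numClashes v ≤
      ∑ u with u ∈ K, (G.midpoints v u).card := by
    rw [Finset.sum_subtype (p := (· ∈ K)) _ (by simp)]
    exact Finset.sum_le_sum fun u _ => Finset.card_image_le
  have hsum := Finset.sum_filter_add_sum_filter_not Finset.univ (· ∈ K)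
    fun u => (G.midpoints v u).card
  have hmid := G.sum_card_midpoints_le v.1
  have hcard : {u | u ∈ K ∧ G.graph.Adj v u}.toFinset.card +
      {m | G.graph.degree m = 2 ∧ G.graph.Adj v m}.toFinset.card ≤ 3 := by
    rw [← hdeg v v.2, ← SimpleGraph.card_neighborFinset_eq_degree, ← Finset.card_union_of_disjoint]
    · exact Finset.card_le_card fun u hu => by
        rw [SimpleGraph.mem_neighborFinset]
        simp only [Finset.mem_union, Set.mem_toFinset, Set.mem_ofPred_eq] at hu
        exact hu.elim And.right And.right
    · refine Finset.disjoint_left.2 fun u hu hu' => ?_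
      simp only [Set.mem_toFinset, Set.mem_ofPred_eq] at hu hu'
      simp [hdeg u hu.1] at hu'
  have hdegree : (G.residualProblem φ K).graph.degree v =
      {u | u ∈ K ∧ G.graph.Adj v u}.toFinset.card := degree_induce_eq_card_filter G.graph K v
  omega

theorem colorableOn_univ_of_forall_degree_eq_two {ψ : V → Color}
    (hindep : ∀ u v, G.graph.degree u = 2 → G.graph.degree v = 2 → ¬ G.graph.Adj u v)
    (hψ : G.IsColoringOn ψ {v | G.graph.degree v ≠ 2})
    (hextend : ∀ m, G.graph.degree m = 2 →
      ∃ d, ∀ u, G.graph.Adj m u → Compatible (G.sign m u) d (ψ u)) :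
    G.ColorableOn Set.univ := by
  choose! d hd using hextend
  refine ⟨fun v => if G.graph.degree v = 2 then d v else ψ v, fun u _ v _ huv => ?_⟩
  by_cases hu : G.graph.degree u = 2 <;> by_cases hv : G.graph.degree v = 2
  · exact absurd huv (hindep u v hu hv)
  · simpa [hu, hv] using hd u hu v huv
  · simpa [hu, hv, G.sign_comm u] using (hd v hv u huv.symm).symm
  · simpa [hu, hv] using hψ u hu v hv huv

theorem colorableOn_univ_of_residualProblem {K : Set V} {φ : V → Color}
    (hindep : ∀ u v, G.graph.degree u = 2 → G.graph.degree v = 2 → ¬ G.graph.Adj u v)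
    (hφ : G.IsColoringOn φ Kᶜ) (hdeg : ∀ v ∈ K, G.graph.degree v ≠ 2)
    (hbdry : ∀ u ∈ K, ∀ v ∉ K, G.graph.Adj u v → G.graph.degree v = 2)
    (hsolv : (G.residualProblem φ K).IsSolvable) : G.ColorableOn Set.univ := by
  obtain ⟨χ, hχ⟩ := hsolv
  set ψ : V → Color := fun v => if hv : v ∈ K then χ ⟨v, hv⟩ else φ v with hψ
  have hψ_mem : ∀ v (hv : v ∈ K), ψ v = χ ⟨v, hv⟩ := fun v hv => by simp [hψ, hv]
  have hψ_notMem : ∀ v ∉ K, ψ v = φ v := fun v hv => by simp [hψ, hv]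
  refine colorableOn_univ_of_forall_degree_eq_two (ψ := ψ) hindep (fun u hu v hv huv => ?_)
    fun m hm => ?_
  · by_cases huK : u ∈ K <;> by_cases hvK : v ∈ K
    · rw [hψ_mem u huK, hψ_mem v hvK]
      exact (hχ ⟨u, huK⟩).compatible ⟨v, hvK⟩ huv
    · exact absurd (hbdry u huK v hvK huv) hv
    · exact absurd (hbdry v hvK u huK huv.symm) hu
    · rw [hψ_notMem u huK, hψ_notMem v hvK]
      exact hφ u huK v hvK huv
  by_cases hmK : ∃ u ∈ K, G.graph.Adj m u
  · obtain ⟨u, huK, hmu⟩ := hmK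
    obtain ⟨v, hvu, hmv, heq⟩ := exists_eq_or_eq_of_degree_eq_two hm hmu
    have hmid : m ∈ G.midpoints u v := mem_midpoints.2 ⟨hvu.symm, hm, hmu, hmv⟩
    have hclash : ¬ Clash (G.sign m u + G.sign m v + 1) (ψ u) (ψ v) := by
      by_cases hvK : v ∈ K
      · rw [hψ_mem u huK, hψ_mem v hvK]
        exact (hχ ⟨u, huK⟩).not_clash ⟨v, hvK⟩ _ (Finset.mem_image_of_mem _ hmid)
      · rw [hψ_mem u huK, hψ_notMem v hvK]
        intro h
        refine (hχ ⟨u, huK⟩).notMem_forbidden (Finset.mem_biUnion.2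
          ⟨v, by simpa using hvK, Finset.mem_image.2 ⟨m, hmid, Prod.ext h.1.symm ?_⟩⟩)
        rw [← h.2, add_left_comm, CharTwo.add_self_eq_zero, add_zero]
    obtain ⟨d, hdu, hdv⟩ := exists_compatible_iff_not_clash.2 hclash
    refine ⟨d, fun x hmx => ?_⟩
    obtain rfl | rfl := heq x hmx
    exacts [hdu, hdv]
  · push Not at hmK
    refine ⟨φ m, fun u hmu => ?_⟩
    have huK : u ∉ K := fun huK => hmK u huK hmu
    rw [hψ_notMem u huK]
    exact hφ m (fun h => hdeg m h hm) u huK hmu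

/-- A claw with centre `w` and ends `u i` of degree three in which consecutive ends have a common
neighbour `m i` of degree two, such that all three 4-cycles that arise have the sign that obstructs
a colouring. -/
structure IsExceptionalConfig (G : SignedGraph V) (w : V) (u m : Fin 3 → V) : Prop where
  injective : Function.Injective u
  degree_center : G.graph.degree w = 3
  degree_end : ∀ i, G.graph.degree (u i) = 3
  adj : ∀ i, G.graph.Adj w (u i)
  mem_midpoints : ∀ i, m i ∈ G.midpoints (u i) (u (i + 1))
  sign_eq : ∀ i, G.sign (m i) (u i) + G.sign (m i) (u (i + 1)) + 1 =
    G.sign w (u i) + G.sign w (u (i + 1))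

theorem exists_isExceptionalConfig {K : Set V} {φ : V → Color} {w : K} {u : Fin 3 → K}
    (h : (G.residualProblem φ K).IsExceptionalStar w u)
    (hdeg : ∀ v ∈ K, G.graph.degree v = 3) :
    ∃ m, G.IsExceptionalConfig w (fun i => u i) m := by
  have hmid : ∀ i, ∃ m ∈ G.midpoints (u i) (u (i + 1)),
      G.sign m (u i) + G.sign m (u (i + 1)) + 1 =
        G.sign w (u i) + G.sign w (u (i + 1)) := fun i => by
    have hne : i ≠ i + 1 := by revert i; decide
    exact Finset.mem_image.1 ((Finset.ext_iff.1 (h.clash_eq i (i + 1) hne) _).2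
      (Finset.mem_singleton_self _))
  choose m hm hsign using hmid
  exact ⟨m, Subtype.val_injective.comp h.injective, hdeg w w.2, fun i => hdeg _ (u i).2, h.adj,
    hm, hsign⟩

theorem IsCritical.le_sum_degree_or_exists_isExceptionalConfig (h : G.IsCritical) :
    8 * Fintype.card V ≤ 3 * ∑ v, G.graph.degree v ∨ ∃ w u m, G.IsExceptionalConfig w u m := by
  by_cases! hsum : 8 * Fintype.card V ≤ 3 * ∑ v, G.graph.degree v
  · exact .inl hsum
  have hindep : ∀ u v, G.graph.degree u = 2 → G.graph.degree v = 2 → ¬ G.graph.Adj u v :=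
    fun _ _ => h.not_adj_of_degree_eq_two
  obtain ⟨K, htree, hdeg, hbdry⟩ :=
    exists_isTree_induce_of_sum_degree_lt h.two_le_degree hindep hsum
  obtain ⟨v, hvK⟩ := htree.1.nonempty
  obtain ⟨φ, hφ⟩ := h.colorableOn Kᶜ ((Set.ne_univ_iff_exists_notMem _).2 ⟨v, by simpa⟩)
  rcases (isSubcubicTree_residualProblem φ htree hdeg).isSolvable_or_exists_isExceptionalStar with
    hsolv | ⟨w, u, hstar⟩
  · exact absurd (colorableOn_univ_of_residualProblem hindep hφ (fun v hv => by simp [hdeg v hv])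
      hbdry hsolv) h.not_colorableOn_univ
  · obtain ⟨m, hm⟩ := exists_isExceptionalConfig hstar hdeg
    exact .inr ⟨w, _, m, hm⟩

end ResidualProblem

end SignedGraph

/-! ### Signed graphs of bipartite oriented graphs -/

namespace OrientedGraph

section SignedGraphOfOrientedGraph

variable {V : Type*} {G : OrientedGraph V} {c : V → ZMod 2} {u v : V}

open scoped Classical in
/-- The signed graph of an oriented graph with bipartition `c`: the sign of an edge is the side of
its tail. Pushing a set of vertices adds to the signs the coboundary of its indicator function. -/
noncomputable def toSignedGraph (G : OrientedGraph V) (c : V → ZMod 2) : SignedGraph V where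
  graph := G.underlying
  sign u v := if G.Arc u v then c u else if G.Arc v u then c v else 0
  sign_comm u v := by
    by_cases huv : G.Arc u v
    · simp [huv, G.asymm u v huv]
    · by_cases hvu : G.Arc v u <;> simp [huv, hvu]

theorem toSignedGraph_sign_of_arc (h : G.Arc u v) : (G.toSignedGraph c).sign u v = c u := by
  simp [toSignedGraph, h]

theorem push_arc_iff (hc : ∀ u v, G.underlying.Adj u v → c v = c u + 1) (q : V → ZMod 2)
    (huv : G.underlying.Adj u v) : (G.push {x | q x = 1}).Arc u v ↔
      (G.toSignedGraph c).sign u v + q u + q v = c u := by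
  have hq : ∀ a b z : ZMod 2, ((a = 1 ↔ b = 1) ↔ z + a + b = z) ∧
      (¬ (a = 1 ↔ b = 1) ↔ z + 1 + a + b = z) := by decide
  rcases huv with harc | harc
  · simpa [push, harc, G.asymm _ _ harc, toSignedGraph_sign_of_arc harc] using (hq _ _ _).1
  · rw [(G.toSignedGraph c).sign_comm, toSignedGraph_sign_of_arc harc, hc u v (.inr harc)]
    simpa [push, harc, G.asymm _ _ harc] using (hq _ _ _).2

theorem underlying_push (G : OrientedGraph V) (S : Set V) :
    (G.push S).underlying = G.underlying := by
  ext u v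
  simp only [underlying, push]
  tauto

theorem exists_bipartition (hG : G.underlying.IsBipartite) :
    ∃ c : V → ZMod 2, ∀ u v, G.underlying.Adj u v → c v = c u + 1 := by
  obtain ⟨(c : G.underlying.Coloring (ZMod 2))⟩ := hG
  have htwo : ∀ a b : ZMod 2, a ≠ b → b = a + 1 := by decide
  exact ⟨c, fun u v huv => htwo _ _ (c.valid huv)⟩

/-- The subgraph of `G` induced by `s`. -/
def induce (G : OrientedGraph V) (s : Set V) : OrientedGraph s where
  Arc u v := G.Arc u v
  asymm u v := G.asymm u v

theorem colorableOn_of_colorableOn_univ_induce {s : Set V}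
    (h : ((G.induce s).toSignedGraph fun v => c v).ColorableOn Set.univ) :
    (G.toSignedGraph c).ColorableOn s := by
  classical
  obtain ⟨φ, hφ⟩ := h
  refine ⟨fun v => if hv : v ∈ s then φ ⟨v, hv⟩ else 0, fun u hu v hv huv => ?_⟩
  simp only [hu, hv, dif_pos]
  exact hφ ⟨u, hu⟩ trivial ⟨v, hv⟩ trivial huv

end SignedGraphOfOrientedGraph

section FourCycle

/-- The side of a vertex of the 4-cycle in its bipartition. -/
def fourCycleSide : Fin 4 → ZMod 2 := ![0, 1, 0, 1]

/-- The position of a vertex of the 4-cycle within its side. -/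
def fourCyclePos : Fin 4 → ZMod 2 := ![0, 0, 1, 1]

/-- The vertex of the 4-cycle on side `c` with position `x`. -/
def fourCycleVertex (c x : ZMod 2) : Fin 4 :=
  if c = 0 then (if x = 0 then 0 else 2) else if x = 0 then 1 else 3

theorem fourCycleSide_fourCycleVertex (c x : ZMod 2) :
    fourCycleSide (fourCycleVertex c x) = c := by
  revert c x
  decide

theorem fourCyclePos_fourCycleVertex (c x : ZMod 2) : fourCyclePos (fourCycleVertex c x) = x := by
  revert c x
  decide

/-- The two inequalities are the definition of an unbalanced 4-cycle for the push sets `∅` and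
`{0}`; together they say that the number of forward arcs is odd. -/
theorem exists_switching_of_card_ne (e : Fin 4 → Bool)
    (hempty : ({i | e i = true} : Finset (Fin 4)).card ≠
      ({i | e i = false} : Finset (Fin 4)).card)
    (hsingle : ({i | e i = decide (i = 0 ↔ i + 1 = 0)} : Finset (Fin 4)).card ≠
      ({i | e i = !decide (i = 0 ↔ i + 1 = 0)} : Finset (Fin 4)).card) :
    ∃ γ : Fin 4 → ZMod 2, ∀ i j, ((j = i + 1 ∧ e i = true) ∨ (i = j + 1 ∧ e j = false)) ↔
      fourCycleSide j = fourCycleSide i + 1 ∧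
        Compatible (fourCycleSide i) (fourCyclePos i, γ i) (fourCyclePos j, γ j) := by
  revert e
  decide

variable {C : OrientedGraph (Fin 4)}

theorem IsUnbalancedFourCycle.adj_iff (hC : C.IsUnbalancedFourCycle) (i j : Fin 4) :
    C.underlying.Adj i j ↔ j = i + 1 ∨ i = j + 1 := by
  rw [hC.1]
  revert i j
  decide

theorem IsUnbalancedFourCycle.arc_succ_iff (hC : C.IsUnbalancedFourCycle) (i : Fin 4) :
    C.Arc (i + 1) i ↔ ¬ C.Arc i (i + 1) :=
  ⟨C.asymm _ _, ((hC.adj_iff i (i + 1)).2 (.inl rfl)).resolve_left⟩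

open scoped Classical in
theorem IsUnbalancedFourCycle.card_ne (hC : C.IsUnbalancedFourCycle) (b : Fin 4 → Prop)
    [DecidablePred b] :
    ({i | decide (C.Arc i (i + 1)) = decide (b i ↔ b (i + 1))} : Finset (Fin 4)).card ≠
      ({i | decide (C.Arc i (i + 1)) = !decide (b i ↔ b (i + 1))} : Finset (Fin 4)).card := by
  convert hC.2 {i | b i} using 1 <;> rw [← Set.ncard_coe_finset] <;> congr 1 <;> ext i <;>
    by_cases hi : b i <;> by_cases hj : b (i + 1) <;> by_cases harc : C.Arc i (i + 1) <;>
    simp [push, hC.arc_succ_iff, hi, hj, harc]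

theorem IsUnbalancedFourCycle.exists_switching (hC : C.IsUnbalancedFourCycle) :
    ∃ γ : Fin 4 → ZMod 2, ∀ i j, C.Arc i j ↔ fourCycleSide j = fourCycleSide i + 1 ∧
      Compatible (fourCycleSide i) (fourCyclePos i, γ i) (fourCyclePos j, γ j) := by
  classical
  obtain ⟨γ, hγ⟩ := exists_switching_of_card_ne (fun i => decide (C.Arc i (i + 1)))
    (by simpa using hC.card_ne fun _ => True) (by simpa using hC.card_ne fun i => i = 0)
  refine ⟨γ, fun i j => Iff.trans ⟨fun h => ?_, ?_⟩ (hγ i j)⟩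
  · rcases (hC.adj_iff i j).1 (.inl h) with rfl | rfl
    · exact .inl ⟨rfl, by simpa using h⟩
    · exact .inr ⟨rfl, by simpa using (hC.arc_succ_iff j).1 h⟩
  · rintro (⟨rfl, h⟩ | ⟨rfl, h⟩)
    · simpa using h
    · exact (hC.arc_succ_iff j).2 (by simpa using h)

variable {V : Type*} {G : OrientedGraph V} {c : V → ZMod 2}

theorem IsUnbalancedFourCycle.colorableOn_of_isHom_push (hC : C.IsUnbalancedFourCycle)
    (hc : ∀ u v, G.underlying.Adj u v → c v = c u + 1) {q : V → ZMod 2} {f : V → Fin 4}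
    (hf : (G.push {x | q x = 1}).IsHom C f) : (G.toSignedGraph c).ColorableOn Set.univ := by
  obtain ⟨γ, hγ⟩ := hC.exists_switching
  set φ : V → Color := fun v =>
    (fourCyclePos (f v), γ (f v) + q v + c v * (c v + fourCycleSide (f v))) with hφ
  have hpush : ∀ u v, (G.push {x | q x = 1}).Arc u v →
      Compatible ((G.toSignedGraph c).sign u v) (φ u) (φ v) := fun u v huv => by
    have hadj : G.underlying.Adj u v := G.underlying_push _ ▸ Or.inl huv
    have hsign := (push_arc_iff hc q hadj).1 huv
    obtain ⟨hside, hcompat⟩ := (hγ _ _).1 (hf u v huv)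
    simp only [hφ, Compatible, hside, hc u v hadj] at hcompat ⊢
    linear_combination (norm := (ring_nf; reduce_mod_char)) hcompat + hsign
  refine ⟨φ, fun u _ v _ huv => ?_⟩
  have hadj : (G.push {x | q x = 1}).underlying.Adj u v := by rwa [underlying_push]
  rcases hadj with h | h
  · exact hpush u v h
  · rw [(G.toSignedGraph c).sign_comm]
    exact (hpush v u h).symm

theorem IsUnbalancedFourCycle.pushablyColorable_of_colorableOn (hC : C.IsUnbalancedFourCycle)
    (hc : ∀ u v, G.underlying.Adj u v → c v = c u + 1)
    (h : (G.toSignedGraph c).ColorableOn Set.univ) : G.PushablyColorable C := by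
  obtain ⟨γ, hγ⟩ := hC.exists_switching
  obtain ⟨φ, hφ⟩ := h
  set f : V → Fin 4 := fun v => fourCycleVertex (c v) (φ v).1 with hf
  refine ⟨f, _, ⟨{v | (φ v).2 + γ (f v) = 1}, rfl⟩, fun u v huv => ?_⟩
  have hadj : G.underlying.Adj u v := G.underlying_push _ ▸ Or.inl huv
  have hsign := (push_arc_iff hc (fun v => (φ v).2 + γ (f v)) hadj).1 huv
  have hcompat := hφ u trivial v trivial hadj
  refine (hγ _ _).2 ⟨by simpa [hf, fourCycleSide_fourCycleVertex] using hc u v hadj, ?_⟩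
  simp only [Compatible, hf, fourCycleSide_fourCycleVertex, fourCyclePos_fourCycleVertex]
    at hcompat hsign ⊢
  linear_combination (norm := (ring_nf; reduce_mod_char)) hcompat + hsign

theorem IsUnbalancedFourCycle.pushablyColorable_iff (hC : C.IsUnbalancedFourCycle)
    (hc : ∀ u v, G.underlying.Adj u v → c v = c u + 1) :
    G.PushablyColorable C ↔ (G.toSignedGraph c).ColorableOn Set.univ := by
  classical
  refine ⟨?_, hC.pushablyColorable_of_colorableOn hc⟩
  rintro ⟨f, _, ⟨S, rfl⟩, hf⟩
  have hS : S = {x | (if x ∈ S then 1 else 0 : ZMod 2) = 1} := by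
    ext x
    simp
  exact hC.colorableOn_of_isHom_push hc (hS ▸ hf)

theorem IsUnbalancedFourCycle.isCritical_toSignedGraph (hC : C.IsUnbalancedFourCycle)
    (hc : ∀ u v, G.underlying.Adj u v → c v = c u + 1) (hG : ¬ G.PushablyColorable C)
    (hinduce : ∀ s ≠ Set.univ, (G.induce s).PushablyColorable C) :
    (G.toSignedGraph c).IsCritical where
  not_colorableOn_univ := mt (hC.pushablyColorable_iff hc).2 hG
  colorableOn s hs := colorableOn_of_colorableOn_univ_induce
    ((hC.pushablyColorable_iff (G := G.induce s) fun u v => hc u v).1 (hinduce s hs))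

end FourCycle

section Counting

variable {V W : Type*} {G : OrientedGraph V} {H : OrientedGraph W}

theorem numArcs_eq_ncard_edgeSet (G : OrientedGraph V) :
    G.numArcs = G.underlying.edgeSet.ncard := by
  have hinj : Set.InjOn (fun p : V × V => s(p.1, p.2)) {p | G.Arc p.1 p.2} := by
    rintro ⟨u, v⟩ huv ⟨x, y⟩ hxy h
    rcases Sym2.eq_iff.1 h with ⟨rfl, rfl⟩ | ⟨rfl, rfl⟩
    · rfl
    · exact absurd hxy (G.asymm _ _ huv)
  rw [numArcs, ← hinj.ncard_image]
  congr 1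
  ext ⟨u, v⟩
  constructor
  · rintro ⟨⟨x, y⟩, hxy, h⟩
    rw [← h]
    exact Or.inl hxy
  · rintro (huv | hvu)
    exacts [⟨(u, v), huv, rfl⟩, ⟨(v, u), hvu, Sym2.eq_swap⟩]

theorem numArcs_push (G : OrientedGraph V) (S : Set V) : (G.push S).numArcs = G.numArcs := by
  rw [numArcs_eq_ncard_edgeSet, underlying_push, ← numArcs_eq_ncard_edgeSet]

open scoped Classical in
theorem sum_degree_underlying [Fintype V] (G : OrientedGraph V) :
    ∑ v, G.underlying.degree v = 2 * G.numArcs := by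
  rw [SimpleGraph.sum_degrees_eq_twice_card_edges, numArcs_eq_ncard_edgeSet,
    ← SimpleGraph.coe_edgeFinset, Set.ncard_coe_finset]

theorem IsHom.isomorphic [Finite W] {g : V → W} (hg : G.IsHom H g) (hbij : g.Bijective)
    (hcard : H.numArcs ≤ G.numArcs) : H.Isomorphic G := by
  have himage : Prod.map g g '' {p | G.Arc p.1 p.2} = {p | H.Arc p.1 p.2} := by
    refine Set.eq_of_subset_of_ncard_le ?_ ?_
    · rintro _ ⟨p, hp, rfl⟩
      exact hg _ _ hp
    · rwa [Set.ncard_image_of_injective _ (hbij.1.prodMap hbij.1)]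
  have harc : ∀ a b, H.Arc (g a) (g b) ↔ G.Arc a b := fun a b => by
    refine ⟨fun h => ?_, hg a b⟩
    obtain ⟨p, hp, heq⟩ := himage.ge (show (g a, g b) ∈ {p | H.Arc p.1 p.2} from h)
    obtain rfl : p = (a, b) := hbij.1.prodMap hbij.1 heq
    exact hp
  set e := Equiv.ofBijective g hbij
  refine ⟨e.symm, fun u v => ?_⟩
  rw [← harc]
  exact iff_of_eq (congrArg₂ H.Arc (e.apply_symm_apply u).symm (e.apply_symm_apply v).symm)

theorem numArcs_exceptionalW : exceptionalW.numArcs = 9 :=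
  Set.ncard_coe_finset {(0, 4), (0, 5), (0, 6), (4, 1), (1, 5), (5, 2), (2, 6), (3, 4), (6, 3)}

end Counting

end OrientedGraph

/-! ### The exceptional graph -/

section ExceptionalGraph

open OrientedGraph
open scoped Classical

variable {V : Type*} [Fintype V] {w : V} {u m : Fin 3 → V}

namespace SignedGraph

/-- The vertices of a configuration, in the numbering of the vertices of `exceptionalW`. -/
def configVertex {V : Type*} (w : V) (u m : Fin 3 → V) : Fin 7 → V :=
  Fin.cons w (Fin.append m u)

theorem configVertex_mid {V : Type*} (w : V) (u m : Fin 3 → V) (i : Fin 3) :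
    configVertex w u m (Fin.castAdd 3 i).succ = m i :=
  Fin.append_left m u i

theorem configVertex_end {V : Type*} (w : V) (u m : Fin 3 → V) (i : Fin 3) :
    configVertex w u m (Fin.natAdd 3 i).succ = u i :=
  Fin.append_right m u i

namespace IsExceptionalConfig

variable {S : SignedGraph V}

theorem adj_mid_iff (h : S.IsExceptionalConfig w u m) (i : Fin 3) (x : V) :
    S.graph.Adj (m i) x ↔ x = u i ∨ x = u (i + 1) := by
  obtain ⟨hne, hdeg, hadj, hadj'⟩ := SignedGraph.mem_midpoints.1 (h.mem_midpoints i)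
  obtain ⟨y, -, -, hy⟩ := exists_eq_or_eq_of_degree_eq_two hdeg hadj
  obtain rfl := (hy _ hadj').resolve_left hne.symm
  refine ⟨hy x, ?_⟩
  rintro (rfl | rfl) <;> assumption

theorem degree_mid (h : S.IsExceptionalConfig w u m) (i : Fin 3) : S.graph.degree (m i) = 2 :=
  (SignedGraph.mem_midpoints.1 (h.mem_midpoints i)).2.1

theorem injective_mid (h : S.IsExceptionalConfig w u m) : Function.Injective m := by
  intro i j hij
  have hj := (h.adj_mid_iff i (u j)).1 (hij ▸ (h.adj_mid_iff j _).2 (.inl rfl))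
  have hj' := (h.adj_mid_iff i (u (j + 1))).1 (hij ▸ (h.adj_mid_iff j _).2 (.inr rfl))
  rw [h.injective.eq_iff, h.injective.eq_iff] at hj hj'
  clear hij
  revert i j
  decide

theorem injective_configVertex (h : S.IsExceptionalConfig w u m) :
    Function.Injective (configVertex w u m) := by
  refine Fin.cons_injective_iff.2 ⟨?_, Fin.append_injective_iff.2
    ⟨h.injective_mid, h.injective, fun i j hij => ?_⟩⟩
  · rintro ⟨k, hk⟩
    induction k using Fin.addCases (m := 3) (n := 3) with
    | left i =>
      rw [Fin.append_left] at hk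
      have := h.degree_mid i
      rw [hk, h.degree_center] at this
      omega
    | right i =>
      rw [Fin.append_right] at hk
      exact (h.adj i).ne hk.symm
  · have := h.degree_mid i
    rw [hij, h.degree_end] at this
    omega

/-- Along a correct colouring, two ends with a common midpoint would have different first
components, but there are three ends and two values. -/
theorem not_colorableOn_range (h : S.IsExceptionalConfig w u m) :
    ¬ S.ColorableOn (Set.range (configVertex w u m)) := by
  rintro ⟨φ, hφ⟩
  have hw : w ∈ Set.range (configVertex w u m) := ⟨0, rfl⟩
  have hu : ∀ i, u i ∈ Set.range (configVertex w u m) := fun i =>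
    ⟨_, configVertex_end w u m i⟩
  have hm : ∀ i, m i ∈ Set.range (configVertex w u m) := fun i =>
    ⟨_, configVertex_mid w u m i⟩
  have hne : ∀ i, (φ (u i)).1 ≠ (φ (u (i + 1))).1 := fun i heq =>
    exists_compatible_iff_not_clash.1
      ⟨φ (m i), hφ _ (hm i) _ (hu i) ((h.adj_mid_iff i _).2 (.inl rfl)),
        hφ _ (hm i) _ (hu (i + 1)) ((h.adj_mid_iff i _).2 (.inr rfl))⟩
      (h.sign_eq i ▸ clash_of_compatible (hφ w hw _ (hu i) (h.adj i))
        (hφ w hw _ (hu (i + 1)) (h.adj (i + 1))) heq)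
  have hpigeon : ∀ x : Fin 3 → ZMod 2, ∃ i, x i = x (i + 1) := by decide
  obtain ⟨i, hi⟩ := hpigeon fun i => (φ (u i)).1
  exact hne i hi

theorem bijective_configVertex (h : S.IsExceptionalConfig w u m) (hS : S.IsCritical) :
    Function.Bijective (configVertex w u m) :=
  ⟨h.injective_configVertex, Set.range_eq_univ.1 (by_contra fun hne =>
    h.not_colorableOn_range (hS.colorableOn _ hne))⟩

theorem sum_degree (h : S.IsExceptionalConfig w u m) (hS : S.IsCritical) :
    ∑ v, S.graph.degree v = 18 := by
  have hmid (i : Fin 3) : S.graph.degree (configVertex w u m (Fin.castAdd 3 i).succ) = 2 := by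
    rw [configVertex_mid, h.degree_mid]
  have hend (i : Fin 3) : S.graph.degree (configVertex w u m (Fin.natAdd 3 i).succ) = 3 := by
    rw [configVertex_end, h.degree_end]
  calc ∑ v, S.graph.degree v
    _ = ∑ i, S.graph.degree (configVertex w u m i) :=
        ((h.bijective_configVertex hS).sum_comp _).symm
    _ = S.graph.degree w +
          (∑ i : Fin 3, S.graph.degree (configVertex w u m (Fin.castAdd 3 i).succ) +
            ∑ i : Fin 3, S.graph.degree (configVertex w u m (Fin.natAdd 3 i).succ)) := by
        rw [Fin.sum_univ_succ, Fin.sum_univ_add (a := 3) (b := 3)]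
        rfl
    _ = 18 := by
        simp only [hmid, hend, h.degree_center, Finset.sum_const, Finset.card_fin, smul_eq_mul]

end IsExceptionalConfig

end SignedGraph

namespace OrientedGraph

variable {G : OrientedGraph V} {c : V → ZMod 2}

theorem exists_isHom_push_configVertex (hc : ∀ u v, G.underlying.Adj u v → c v = c u + 1)
    (h : (G.toSignedGraph c).IsExceptionalConfig w u m) :
    ∃ S, exceptionalW.IsHom (G.push S) (configVertex w u m) := by
  set S := G.toSignedGraph c with hS
  obtain ⟨q, hq⟩ : ∃ q : V → ZMod 2, q ∘ configVertex w u m =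
      configVertex (0 : ZMod 2) (fun i => S.sign w (u i) + c w)
        (fun i => S.sign (m i) (u (i + 1)) + S.sign w (u (i + 1))) :=
    ⟨_, Function.extend_comp h.injective_configVertex _ fun _ => 0⟩
  have hqw : q w = 0 := congrFun hq 0
  have hqu : ∀ i, q (u i) = S.sign w (u i) + c w := fun i => by
    simpa only [Function.comp_apply, configVertex_end] using congrFun hq (Fin.natAdd 3 i).succ
  have hqm : ∀ i, q (m i) = S.sign (m i) (u (i + 1)) + S.sign w (u (i + 1)) := fun i => by
    simpa only [Function.comp_apply, configVertex_mid] using congrFun hq (Fin.castAdd 3 i).succ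
  have hmu : ∀ i, G.underlying.Adj (m i) (u i) := fun i => (h.adj_mid_iff i _).2 (.inl rfl)
  have hmu' : ∀ i, G.underlying.Adj (m i) (u (i + 1)) := fun i =>
    (h.adj_mid_iff i _).2 (.inr rfl)
  have hcu : ∀ i, c (u i) = c w + 1 := fun i => hc _ _ (h.adj i)
  have hcm : ∀ i, c (m i) = c w := fun i =>
    add_right_cancel ((hc _ _ (hmu i)).symm.trans (hcu i))
  have harc_center : ∀ i, (G.push {x | q x = 1}).Arc w (u i) := fun i => by
    rw [push_arc_iff hc q (h.adj i), ← hS, hqw, hqu]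
    linear_combination (norm := (ring_nf; reduce_mod_char))
  have harc_end : ∀ i, (G.push {x | q x = 1}).Arc (u i) (m i) := fun i => by
    rw [push_arc_iff hc q (hmu i).symm, ← hS, S.sign_comm, hqm, hqu, hcu]
    linear_combination (norm := (ring_nf; reduce_mod_char)) h.sign_eq i
  have harc_mid : ∀ i, (G.push {x | q x = 1}).Arc (m i) (u (i + 1)) := fun i => by
    rw [push_arc_iff hc q (hmu' i), ← hS, hqm, hqu, hcm]
    linear_combination (norm := (ring_nf; reduce_mod_char))
  refine ⟨{x | q x = 1}, fun i j hij => ?_⟩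
  simp only [exceptionalW, Finset.mem_insert, Finset.mem_singleton, Prod.mk.injEq] at hij
  rcases hij with ⟨rfl, rfl⟩ | ⟨rfl, rfl⟩ | ⟨rfl, rfl⟩ | ⟨rfl, rfl⟩ | ⟨rfl, rfl⟩ | ⟨rfl, rfl⟩ |
    ⟨rfl, rfl⟩ | ⟨rfl, rfl⟩ | ⟨rfl, rfl⟩
  exacts [harc_center 0, harc_center 1, harc_center 2, harc_end 0, harc_mid 0, harc_end 1,
    harc_mid 1, harc_mid 2, harc_end 2]

theorem exists_pushEquivalent_isomorphic_exceptionalW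
    (hc : ∀ u v, G.underlying.Adj u v → c v = c u + 1)
    (hcrit : (G.toSignedGraph c).IsCritical)
    (h : (G.toSignedGraph c).IsExceptionalConfig w u m) :
    ∃ G', G.PushEquivalent G' ∧ G'.Isomorphic exceptionalW := by
  obtain ⟨S, hS⟩ := exists_isHom_push_configVertex hc h
  have hsum : 2 * G.numArcs = 18 := by
    rw [← sum_degree_underlying]
    exact h.sum_degree hcrit
  refine ⟨G.push S, ⟨S, rfl⟩, hS.isomorphic (h.bijective_configVertex hcrit) ?_⟩
  rw [numArcs_push, numArcs_exceptionalW]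
  omega

end OrientedGraph

end ExceptionalGraph

theorem mainTheorem10_general {V : Type*} [Fintype V]
    (C : OrientedGraph (Fin 4)) (hC : C.IsUnbalancedFourCycle)
    (G : OrientedGraph V) (hbip : G.underlying.IsBipartite) (hG : ¬ G.PushablyColorable C)
    (hinduce : ∀ s ≠ Set.univ, (G.induce s).PushablyColorable C)
    (hW : ∀ G' : OrientedGraph V, G.PushEquivalent G' →
      ¬ G'.Isomorphic OrientedGraph.exceptionalW) :
    (4 * (Fintype.card V : ℚ)) / 3 ≤ (G.numArcs : ℚ) := by
  classical
  obtain ⟨c, hc⟩ := OrientedGraph.exists_bipartition hbip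
  have hcrit := hC.isCritical_toSignedGraph hc hG hinduce
  rcases hcrit.le_sum_degree_or_exists_isExceptionalConfig with hsum | ⟨w, u, m, hconfig⟩
  · have hbound : 8 * Fintype.card V ≤ 3 * (2 * G.numArcs) := by
      rw [← G.sum_degree_underlying]
      exact hsum
    qify at hbound
    linarith
  · obtain ⟨G', hG', hiso⟩ :=
      OrientedGraph.exists_pushEquivalent_isomorphic_exceptionalW hc hcrit hconfig
    exact absurd hiso (hW G' hG')

theorem mainTheorem10 {V : Type*} [Fintype V]
    (C : OrientedGraph (Fin 4)) (hC : C.IsUnbalancedFourCycle)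
    (G : OrientedGraph V) (hbip : G.underlying.IsBipartite)
    (hcrit : G.IsPushableCritical C)
    (hW : ∀ G' : OrientedGraph V, G.PushEquivalent G' →
      ¬ G'.Isomorphic OrientedGraph.exceptionalW) :
    (4 * (Fintype.card V : ℚ)) / 3 ≤ (G.numArcs : ℚ) :=
  mainTheorem10_general C hC G hbip hcrit.1
    (fun s hs => hcrit.2 s (G.induce s) ⟨fun _ _ => id, .inl hs⟩) hW
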